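/- Let $(M^n,g)$ be a smooth Riemannian manifold of dimension $n\ge 2$, let $U\subset M$ be open, and let $u:U\to(0,\infty)$ be a smooth function with $\Delta u^2=2n\,|\nabla u|^2$ on $U$. Let $B=\mathrm{Hess}_{u^2}-2|\nabla u|^2 g$ be the trace-free Hessian of $u^2$. At points where $\nabla u\ne 0$ let $\mathbf n=\nabla u/|\nabla u|$ be the unit normal of the level sets of $u$; let $\mathrm{II}(v,w)=\langle\nabla_v\mathbf n,w\rangle$ (for $v,w$ tangent to the level set) be the second fundamental form of the level set and $\mathrm{II}_0=\mathrm{II}-\frac{\operatorname{tr}\mathrm{II}}{n-1}\,g$ its trace-free part; let $B(\mathbf n)$ be the vector with $\langle B(\mathbf n),v\rangle=B(\mathbf n,v)$ for all $v$, and $B(\mathbf n)^T$ its orthogonal projection to the tangent space of the level set. Then near every point of $U$ at which $\nabla u\ne0$ the function $|\nabla u|$ is smooth, and at every such point $$ \Delta|\nabla u| = |\nabla u|\,|\mathrm{II}_0|^2+\frac{\mathrm{Ric}(\nabla u,\nabla u)}{|\nabla u|}+\frac{n-2}{u^2}\,\langle\nabla|\nabla u|,\nabla u^2\rangle+\frac{|B(\mathbf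 n)|^2+(n-2)\,|B(\mathbf n)^T|^2}{4(n-1)\,|\nabla u|\,u^2}. $$ -/

import Mathlib

open Bundle
open scoped Manifold ContDiff

/-! ### Bilinear forms on a finite-dimensional real inner product space -/

section BilinearForms

variable {V : Type*} [NormedAddCommGroup V] [InnerProductSpace ℝ V] [FiniteDimensional ℝ V]

/-- The trace `∑ᵢ T(eᵢ, eᵢ)` of a bilinear form, `(eᵢ)` an orthonormal basis. -/
noncomputable def formTrace (T : V →L[ℝ] V →L[ℝ] ℝ) : ℝ :=
  ∑ i, T (stdOrthonormalBasis ℝ V i) (stdOrthonormalBasis ℝ V i)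

/-- The squared norm `|T|² = ∑ᵢⱼ T(eᵢ, eⱼ)²` of a bilinear form, `(eᵢ)` an orthonormal basis. -/
noncomputable def formNormSq (T : V →L[ℝ] V →L[ℝ] ℝ) : ℝ :=
  ∑ i, ∑ j, (T (stdOrthonormalBasis ℝ V i) (stdOrthonormalBasis ℝ V j)) ^ 2

/-- The vector representing a linear functional: `⟪formSharp ℓ, v⟫ = ℓ v` for all `v`. -/
noncomputable def formSharp (l : V →L[ℝ] ℝ) : V :=
  haveI : CompleteSpace V := FiniteDimensional.complete ℝ V
  (InnerProductSpace.toDual ℝ V).symm l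

/-- The inner product of `V`, as a bilinear form. -/
noncomputable def innerForm : V →L[ℝ] V →L[ℝ] ℝ :=
  innerSL ℝ

/-- The trace-free part `T - (tr T / dim V) ⟪·, ·⟫` of a bilinear form. -/
noncomputable def formTraceFree (T : V →L[ℝ] V →L[ℝ] ℝ) : V →L[ℝ] V →L[ℝ] ℝ :=
  T - (formTrace T / (Module.finrank ℝ V : ℝ)) • innerForm

end BilinearForms

/-! ### Partial derivatives in `ℝⁿ` -/

/-- The `i`-th partial derivative of `f : ℝⁿ → ℝ` at `y`. -/
noncomputable def partialD {n : ℕ} (i : Fin n) (f : EuclideanSpace ℝ (Fin n) → ℝ)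
    (y : EuclideanSpace ℝ (Fin n)) : ℝ :=
  fderiv ℝ f y (EuclideanSpace.single i 1)

section Riemannian

variable (n : ℕ) {M : Type*} [TopologicalSpace M] [ChartedSpace (EuclideanSpace ℝ (Fin n)) M]
  [IsManifold (𝓡 n) ∞ M]

/-- Tangent spaces are finite-dimensional. -/
instance tangentSpaceFiniteDimensional (p : M) :
    FiniteDimensional ℝ (TangentSpace (𝓡 n) p) :=
  inferInstanceAs (FiniteDimensional ℝ (EuclideanSpace ℝ (Fin n)))

/-! ### Coordinates: everything below is written in the preferred chart at a point `c` -/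

/-- The coordinate vector field `∂ᵢ` at `q` of the chart at `c` (for `q` in the chart domain). -/
noncomputable def coordField (c q : M) (i : Fin n) : TangentSpace (𝓡 n) q :=
  (trivializationAt (EuclideanSpace ℝ (Fin n)) (TangentSpace (𝓡 n)) c).symmL ℝ q
    (EuclideanSpace.single i 1)

/-- The coordinate one-form `dxⁱ` at `q` of the chart at `c` (for `q` in the chart domain). -/
noncomputable def coordForm (c q : M) (i : Fin n) : TangentSpace (𝓡 n) q →L[ℝ] ℝ :=
  (EuclideanSpace.proj i : EuclideanSpace ℝ (Fin n) →L[ℝ] ℝ) ∘L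
    (trivializationAt (EuclideanSpace ℝ (Fin n)) (TangentSpace (𝓡 n)) c).continuousLinearMapAt ℝ q

/-- A real function on `M`, read in the chart at `c`. -/
noncomputable def chartRead (c : M) (f : M → ℝ) : EuclideanSpace ℝ (Fin n) → ℝ :=
  fun y => f ((extChartAt (𝓡 n) c).symm y)

/-- The covariant `2`-tensor `∑ᵢⱼ tᵢⱼ dxⁱ ⊗ dxʲ` at `p`, in the chart at `p`. -/
noncomputable def formOfCoeff (p : M) (t : Fin n → Fin n → ℝ) :
    TangentSpace (𝓡 n) p →L[ℝ] TangentSpace (𝓡 n) p →L[ℝ] ℝ :=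
  ∑ i, ∑ j, t i j • (coordForm n p p i).smulRight (coordForm n p p j)

variable [RiemannianBundle (fun x : M => TangentSpace (𝓡 n) x)]

/-- The metric coefficients `gᵢⱼ = ⟪∂ᵢ, ∂ⱼ⟫` in the chart at `c`. -/
noncomputable def metricCoeff (c : M) (y : EuclideanSpace ℝ (Fin n)) : Matrix (Fin n) (Fin n) ℝ :=
  Matrix.of fun i j =>
    chartRead n c (fun q : M => inner ℝ (coordField n c q i) (coordField n c q j)) y

/-- The Christoffel symbols `Γᵏᵢⱼ = ½ ∑ₗ gᵏˡ (∂ᵢ gⱼₗ + ∂ⱼ gᵢₗ - ∂ₗ gᵢⱼ)` of the Levi-Civita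
connection in the chart at `c`. -/
noncomputable def christoffel (c : M) (k i j : Fin n) (y : EuclideanSpace ℝ (Fin n)) : ℝ :=
  (1 / 2) * ∑ l, (metricCoeff n c y)⁻¹ k l *
    (partialD i (fun z => metricCoeff n c z j l) y + partialD j (fun z => metricCoeff n c z i l) y
      - partialD l (fun z => metricCoeff n c z i j) y)

/-- The Levi-Civita covariant derivative `v ↦ ∇ᵥ X` of a vector field `X` at `p`:
`∇ᵥ X = ∑ₖᵢ vⁱ (∂ᵢ Xᵏ + ∑ⱼ Γᵏᵢⱼ Xʲ) ∂ₖ`. -/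
noncomputable def covDeriv (X : (q : M) → TangentSpace (𝓡 n) q) (p : M) :
    TangentSpace (𝓡 n) p →L[ℝ] TangentSpace (𝓡 n) p :=
  ∑ k, (∑ i, (partialD i (chartRead n p fun q => coordForm n p q k (X q)) (extChartAt (𝓡 n) p p)
    + ∑ j, christoffel n p k i j (extChartAt (𝓡 n) p p) * coordForm n p p j (X p)) •
      coordForm n p p i).smulRight (coordField n p p k)

/-- The Hessian of `f` at `p`: `(Hess f)ᵢⱼ = ∂ᵢ∂ⱼ f - ∑ₖ Γᵏᵢⱼ ∂ₖ f`. -/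
noncomputable def hessian (f : M → ℝ) (p : M) :
    TangentSpace (𝓡 n) p →L[ℝ] TangentSpace (𝓡 n) p →L[ℝ] ℝ :=
  formOfCoeff n p fun i j =>
    partialD i (partialD j (chartRead n p f)) (extChartAt (𝓡 n) p p)
      - ∑ k, christoffel n p k i j (extChartAt (𝓡 n) p p) *
          partialD k (chartRead n p f) (extChartAt (𝓡 n) p p)

/-- The Laplacian, the trace of the Hessian. -/
noncomputable def laplacian (f : M → ℝ) (p : M) : ℝ :=
  formTrace (hessian n f p)

/-- The gradient, the vector dual to the differential. -/
noncomputable def grad (f : M → ℝ) (p : M) : TangentSpace (𝓡 n) p :=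
  formSharp (mvfderiv (𝓡 n) f p)

/-- The curvature components `Rˡⱼₖᵢ`, that is
`∇_∂ₖ ∇_∂ᵢ ∂ⱼ - ∇_∂ᵢ ∇_∂ₖ ∂ⱼ = ∑ₗ Rˡⱼₖᵢ ∂ₗ`, in the chart at `c`. -/
noncomputable def curvatureCoeff (c : M) (l j k i : Fin n) (y : EuclideanSpace ℝ (Fin n)) : ℝ :=
  partialD k (christoffel n c l i j) y - partialD i (christoffel n c l k j) y
    + ∑ m, (christoffel n c l k m y * christoffel n c m i j y
      - christoffel n c l i m y * christoffel n c m k j y)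

/-- The Ricci tensor `Ric(X, Y) = tr (Z ↦ R(Z, X)Y)`, `Ricᵢⱼ = ∑ₖ Rᵏⱼₖᵢ`. -/
noncomputable def ricci (p : M) :
    TangentSpace (𝓡 n) p →L[ℝ] TangentSpace (𝓡 n) p →L[ℝ] ℝ :=
  formOfCoeff n p fun i j => ∑ k, curvatureCoeff n p k j k i (extChartAt (𝓡 n) p p)

/-! ### Level sets and the trace-free Hessian of `u²` -/

/-- The unit normal `𝐧 = ∇u / |∇u|` to the level sets of `u`. -/
noncomputable def unitNormal (u : M → ℝ) (p : M) : TangentSpace (𝓡 n) p :=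
  ‖grad n u p‖⁻¹ • grad n u p

/-- The tangent space at `p` of the level set of `u` through `p`, the kernel of `duₚ`. -/
noncomputable def levelTangent (u : M → ℝ) (p : M) : Submodule ℝ (TangentSpace (𝓡 n) p) :=
  LinearMap.ker (mvfderiv (𝓡 n) u p : TangentSpace (𝓡 n) p →ₗ[ℝ] ℝ)

/-- The second fundamental form `II(v, w) = ⟪∇ᵥ 𝐧, w⟫` of the level set of `u` through `p`. -/
noncomputable def secondFundamentalForm (u : M → ℝ) (p : M) :
    levelTangent n u p →L[ℝ] levelTangent n u p →L[ℝ] ℝ :=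
  (innerForm ∘L covDeriv n (unitNormal n u) p).bilinearComp
    (levelTangent n u p).subtypeL (levelTangent n u p).subtypeL

/-- The tensor `B = Hess (u²) - 2 |∇u|² g`, which is the trace-free Hessian of `u²` if
`Δ u² = 2 n |∇u|²`. -/
noncomputable def tensorB (u : M → ℝ) (p : M) :
    TangentSpace (𝓡 n) p →L[ℝ] TangentSpace (𝓡 n) p →L[ℝ] ℝ :=
  hessian n (fun q => u q ^ 2) p - (2 * ‖grad n u p‖ ^ 2) • innerForm

/-- The vector `B(𝐧)`, given by `⟪B(𝐧), v⟫ = B(𝐧, v)`. -/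
noncomputable def vectorB (u : M → ℝ) (p : M) : TangentSpace (𝓡 n) p :=
  formSharp (tensorB n u p (unitNormal n u p))

/-- The part `B(𝐧)ᵀ` of `B(𝐧)` tangent to the level set (its orthogonal projection). -/
noncomputable def vectorBTangent (u : M → ℝ) (p : M) : levelTangent n u p :=
  (levelTangent n u p).orthogonalProjectionOnto (vectorB n u p)

end Riemannian

/-! ### Traces and norms of bilinear forms, split along a hyperplane and its unit normal. -/

section TraceForms

set_option linter.unusedSectionVars false

open scoped RealInnerProductSpace

variable {V : Type*} [NormedAddCommGroup V] [InnerProductSpace ℝ V] [FiniteDimensional ℝ V]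

/-! Write `w = |∇u|`, `A = Hess u` as a symmetric endomorphism, `ν = ∇u / w`, `a = ⟪Aν, ν⟫`, `T` for
the tangential part of `Aν`, and `C` for the compression of `A` to the level set's tangent space.
The equation for `u²` says `tr A = Δu = (n - 1) w² / u`. Since `∇w = A∇u / w`, Bochner's formula
`div (A∇u) = |A|² + Ric(∇u, ∇u) + ⟪∇u, ∇Δu⟫` and the quotient rule express `w Δw` as `|A|² + Ric(∇u,
∇u) + (n - 1)(2aw²/u - w⁴/u²) - |Aν|²`.

The rest is linear algebra: `|A|² = |C|² + 2|T|² + a²`, `|Aν|² = |T|² + a²`, `II = C / w`, so `|C|²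
= w²|II₀|² + (tr C)²/(n - 1)` with `tr C = (n - 1) w²/u - a`. What remains besides `w²|II₀|²` and
Ricci is `2(n - 2) a w²/u + a²/(n - 1) + |T|²`. The first term is the gradient pairing. As `B(ν) =
2u Aν`, the other two are the quotient with `B`.

The calculus is done for a metric on an open subset of a vector space (`SmoothMetricOn`), Bochner's
formula being `trace_nablaAt_hessAt_gradAt`. Carrying it to `M` needs `christoffel_eq` and its
consequences, which match the coordinate formulas with this calculus. It also needs `hessEndo_eq`:
the Laplacian at each point is defined in that point's own chart, yet `Δu` must be differentiated in
one fixed chart. The pieces meet in `laplacian_norm_grad_eq`. -/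

theorem innerForm_apply (v w : V) : innerForm v w = ⟪v, w⟫ := rfl

theorem inner_formSharp (l : V →L[ℝ] ℝ) (v : V) : ⟪formSharp l, v⟫ = l v := by
  have : CompleteSpace V := FiniteDimensional.complete ℝ V
  exact InnerProductSpace.toDual_symm_apply

theorem formTrace_eq_trace (T : V →L[ℝ] V →L[ℝ] ℝ) (A : V →ₗ[ℝ] V)
    (h : ∀ v w, T v w = ⟪A v, w⟫) : formTrace T = LinearMap.trace ℝ V A := by
  rw [LinearMap.trace_eq_sum_inner A (stdOrthonormalBasis ℝ V), formTrace]
  exact Finset.sum_congr rfl fun i _ => by rw [h, real_inner_comm]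

theorem formNormSq_eq_trace (T : V →L[ℝ] V →L[ℝ] ℝ) (A : V →ₗ[ℝ] V)
    (h : ∀ v w, T v w = ⟪A v, w⟫) (hA : A.IsSymmetric) :
    formNormSq T = LinearMap.trace ℝ V (A ∘ₗ A) := by
  rw [LinearMap.trace_eq_sum_inner _ (stdOrthonormalBasis ℝ V), formNormSq]
  refine Finset.sum_congr rfl fun i _ => ?_
  rw [LinearMap.comp_apply, ← hA, ← OrthonormalBasis.sum_inner_mul_inner (stdOrthonormalBasis ℝ V)]
  exact Finset.sum_congr rfl fun j _ => by rw [h, sq, real_inner_comm (A _) (stdOrthonormalBasis ℝ V j)]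

theorem trace_id_eq_finrank :
    LinearMap.trace ℝ V LinearMap.id = (Module.finrank ℝ V : ℝ) := by simp

/-- `|T - (tr T / m) g|² = |T|² - (tr T)² / m`. -/
theorem formNormSq_formTraceFree (T : V →L[ℝ] V →L[ℝ] ℝ) (A : V →ₗ[ℝ] V)
    (h : ∀ v w, T v w = ⟪A v, w⟫) (hA : A.IsSymmetric) :
    formNormSq (formTraceFree T) =
      LinearMap.trace ℝ V (A ∘ₗ A) - (LinearMap.trace ℝ V A) ^ 2 / (Module.finrank ℝ V : ℝ) := by
  set m : ℝ := (Module.finrank ℝ V : ℝ) with hm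
  set t : ℝ := LinearMap.trace ℝ V A with ht
  have h' : ∀ v w, formTraceFree T v w = ⟪(A - (t / m) • (LinearMap.id : V →ₗ[ℝ] V)) v, w⟫ := by
    intro v w
    simp [formTraceFree, formTrace_eq_trace T A h, innerForm_apply, inner_sub_left, inner_smul_left, h,
      ← hm, ← ht]
  have hA' : (A - (t / m) • (LinearMap.id : V →ₗ[ℝ] V)).IsSymmetric := by
    intro v w
    simp [inner_sub_left, inner_sub_right, inner_smul_left, inner_smul_right, hA v w]
  rw [formNormSq_eq_trace _ _ h' hA']
  have e : (A - (t / m) • LinearMap.id) ∘ₗ (A - (t / m) • (LinearMap.id : V →ₗ[ℝ] V)) =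
      A ∘ₗ A - (2 * (t / m)) • A + (t / m) ^ 2 • LinearMap.id := by
    ext v
    simp only [LinearMap.comp_apply, LinearMap.sub_apply, LinearMap.smul_apply, LinearMap.id_apply,
      map_sub, map_smul, LinearMap.add_apply]
    module
  rw [e]
  simp only [map_add, map_sub, map_smul, smul_eq_mul, ← ht, trace_id_eq_finrank, ← hm]
  -- In dimension zero division by `m` returns zero, and the correction terms vanish on both sides.
  by_cases h0 : m = 0
  · simp [h0]
  · field_simp
    ring

/-- The compression of an endomorphism to a subspace. -/
noncomputable def compression (K : Submodule ℝ V) (A : V →ₗ[ℝ] V) : K →ₗ[ℝ] K :=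
  (K.orthogonalProjectionOnto : V →ₗ[ℝ] K) ∘ₗ A ∘ₗ K.subtype

theorem inner_compression (K : Submodule ℝ V) (A : V →ₗ[ℝ] V) (v w : K) :
    ⟪compression K A v, w⟫ = ⟪A v, (w : V)⟫ := by
  simp [compression]

variable {K : Submodule ℝ V} {ν : V}

theorem eq_projection_add (hν : ‖ν‖ = 1) (hK : ∀ v, v ∈ K ↔ ⟪ν, v⟫ = 0) (v : V) :
    v = (K.orthogonalProjectionOnto v : V) + ⟪ν, v⟫ • ν := by
  have hmem : v - ⟪ν, v⟫ • ν ∈ K := by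
    rw [hK, inner_sub_right, inner_smul_right, real_inner_self_eq_norm_sq, hν]; ring
  have := Submodule.eq_starProjection_of_mem_of_inner_eq_zero (K := K) (u := v) hmem (by
    intro w hw
    rw [sub_sub_cancel, inner_smul_left, (hK w).1 hw, mul_zero])
  have h2 : (K.orthogonalProjectionOnto v : V) = v - ⟪ν, v⟫ • ν := by
    rw [← this]; rfl
  rw [h2]; abel

/-- Precomposing with `v = P v + ⟪ν, v⟫ ν` gives `A = A ι P + ⟪ν, ·⟫ Aν`. Cyclicity turns the first
trace into that of `P A ι`, and the trace of a rank-one map is an evaluation. -/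
theorem trace_eq_trace_compression_add (hν : ‖ν‖ = 1) (hK : ∀ v, v ∈ K ↔ ⟪ν, v⟫ = 0)
    (A : V →ₗ[ℝ] V) :
    LinearMap.trace ℝ V A = LinearMap.trace ℝ K (compression K A) + ⟪A ν, ν⟫ := by
  have e : A = (A ∘ₗ K.subtype) ∘ₗ (K.orthogonalProjectionOnto : V →ₗ[ℝ] K) +
      ((innerSL ℝ ν : V →L[ℝ] ℝ) : V →ₗ[ℝ] ℝ).smulRight (A ν) := by
    ext v
    conv_lhs => rw [eq_projection_add hν hK v]
    simp
  conv_lhs => rw [e]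
  rw [map_add, LinearMap.trace_comp_comm', LinearMap.trace_smulRight]
  simp [compression, real_inner_comm]

theorem norm_sq_eq_projection_add (hν : ‖ν‖ = 1) (hK : ∀ v, v ∈ K ↔ ⟪ν, v⟫ = 0) (v : V) :
    ‖v‖ ^ 2 = ‖K.orthogonalProjectionOnto v‖ ^ 2 + ⟪ν, v⟫ ^ 2 := by
  have h := (hK _).1 (K.orthogonalProjectionOnto v).2
  conv_lhs => rw [eq_projection_add hν hK v]
  rw [norm_add_sq_real, inner_smul_right, real_inner_comm ν, h, norm_smul, hν]
  simp

/-- `tr A² = tr (A|_K)² + 2 |(A ν)ᵀ|² + ⟪A ν, ν⟫²` for a symmetric endomorphism `A`. -/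
theorem trace_comp_self_eq (hν : ‖ν‖ = 1) (hK : ∀ v, v ∈ K ↔ ⟪ν, v⟫ = 0)
    {A : V →ₗ[ℝ] V} (hA : A.IsSymmetric) :
    LinearMap.trace ℝ V (A ∘ₗ A) =
      LinearMap.trace ℝ K (compression K A ∘ₗ compression K A)
        + 2 * ‖K.orthogonalProjectionOnto (A ν)‖ ^ 2 + ⟪ν, A ν⟫ ^ 2 := by
  -- Inserting the splitting between the two factors of `A` leaves a rank-one term, which symmetry
  -- identifies as the tangential part of `A ν` paired with itself.
  have e : compression K (A ∘ₗ A) = compression K A ∘ₗ compression K A +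
      ((innerSL ℝ (K.orthogonalProjectionOnto (A ν)) : K →L[ℝ] ℝ) : K →ₗ[ℝ] ℝ).smulRight
        (K.orthogonalProjectionOnto (A ν)) := by
    ext1 v
    have h1 := eq_projection_add hν hK (A v)
    have h2 : ⟪ν, A v⟫ = ⟪K.orthogonalProjectionOnto (A ν), v⟫ := by
      rw [← hA]; simp
    simp only [compression, LinearMap.comp_apply, LinearMap.add_apply, Submodule.subtype_apply,
      ContinuousLinearMap.coe_coe, LinearMap.smulRight_apply, innerSL_apply_apply]
    conv_lhs => rw [h1]
    rw [map_add, map_smul, map_add, map_smul, h2]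
  -- The factor 2 has two sources: the rank-one term, and the tangential part of `⟪A (A ν), ν⟫ = ‖A
  -- ν‖²`.
  rw [trace_eq_trace_compression_add hν hK, e, map_add, LinearMap.trace_smulRight,
    LinearMap.comp_apply, hA, real_inner_self_eq_norm_sq, norm_sq_eq_projection_add hν hK (A ν)]
  simp only [ContinuousLinearMap.coe_coe, innerSL_apply_apply, real_inner_self_eq_norm_sq]
  ring

end TraceForms

/-! ### Levi-Civita calculus on an open subset of a vector space -/

section LocalRiemannian

set_option linter.unusedSectionVars false
set_option maxSynthPendingDepth 3

variable {E : Type*} [NormedAddCommGroup E] [NormedSpace ℝ E]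

/-- A smooth Riemannian metric `g` on the open set `Ω`. -/
structure SmoothMetricOn (Ω : Set E) (g : E → E →L[ℝ] E →L[ℝ] ℝ) : Prop where
  isOpen : IsOpen Ω
  contDiffOn : ContDiffOn ℝ ∞ g Ω
  symm : ∀ x ∈ Ω, ∀ v w, g x v w = g x w v
  pos : ∀ x ∈ Ω, ∀ v, v ≠ 0 → 0 < g x v v

/-- The vector dual to a functional. -/
noncomputable def sharpAt (g : E → E →L[ℝ] E →L[ℝ] ℝ) (x : E) : (E →L[ℝ] ℝ) →L[ℝ] E :=
  (g x).inverse

/-- The trilinear form `2 ⟪∇ᵥ w, z⟫` for constant vector fields, by the Koszul formula. -/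
noncomputable def koszulForm (g : E → E →L[ℝ] E →L[ℝ] ℝ) (x : E) : E →L[ℝ] E →L[ℝ] E →L[ℝ] ℝ :=
  fderiv ℝ g x + (fderiv ℝ g x).flip
    - ((ContinuousLinearMap.flipₗᵢ ℝ E E ℝ).toContinuousLinearEquiv :
        (E →L[ℝ] E →L[ℝ] ℝ) →L[ℝ] (E →L[ℝ] E →L[ℝ] ℝ)) ∘L (fderiv ℝ g x).flip

/-- The Christoffel symbols, as a bilinear map. -/
noncomputable def connectionForm (g : E → E →L[ℝ] E →L[ℝ] ℝ) (x : E) : E →L[ℝ] E →L[ℝ] E :=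
  (ContinuousLinearMap.compL ℝ E (E →L[ℝ] ℝ) E (sharpAt g x)) ∘L ((1 / 2 : ℝ) • koszulForm g x)

/-- The covariant derivative `v ↦ ∇ᵥ X` of a vector field. -/
noncomputable def nablaAt (g : E → E →L[ℝ] E →L[ℝ] ℝ) (X : E → E) (x : E) : E →L[ℝ] E :=
  fderiv ℝ X x + (connectionForm g x).flip (X x)

/-- The gradient of a function. -/
noncomputable def gradAt (g : E → E →L[ℝ] E →L[ℝ] ℝ) (f : E → ℝ) (x : E) : E :=
  sharpAt g x (fderiv ℝ f x)

/-- The Hessian of a function, as an endomorphism. -/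
noncomputable def hessAt (g : E → E →L[ℝ] E →L[ℝ] ℝ) (f : E → ℝ) (x : E) : E →L[ℝ] E :=
  nablaAt g (gradAt g f) x

/-- The trace of a continuous endomorphism. -/
noncomputable def clmTrace (A : E →L[ℝ] E) : ℝ := LinearMap.trace ℝ E (A : E →ₗ[ℝ] E)

/-- The endomorphism `z ↦ R(z, v) w`. -/
noncomputable def curvEndo (g : E → E →L[ℝ] E →L[ℝ] ℝ) (x v w : E) : E →L[ℝ] E :=
  ((fderiv ℝ (connectionForm g) x).flip v).flip w - (fderiv ℝ (connectionForm g) x v).flip w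
    + (connectionForm g x).flip (connectionForm g x v w)
    - (connectionForm g x v) ∘L ((connectionForm g x).flip w)

theorem koszulForm_apply (g : E → E →L[ℝ] E →L[ℝ] ℝ) (x v w z : E) :
    koszulForm g x v w z =
      fderiv ℝ g x v w z + fderiv ℝ g x w v z - fderiv ℝ g x z v w := by
  simp [koszulForm]

theorem curvEndo_apply (g : E → E →L[ℝ] E →L[ℝ] ℝ) (x v w z : E) :
    curvEndo g x v w z = fderiv ℝ (connectionForm g) x z v w - fderiv ℝ (connectionForm g) x v z w
      + connectionForm g x z (connectionForm g x v w)
      - connectionForm g x v (connectionForm g x z w) := by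
  simp [curvEndo]

theorem nablaAt_apply (g : E → E →L[ℝ] E →L[ℝ] ℝ) (X : E → E) (x v : E) :
    nablaAt g X x v = fderiv ℝ X x v + connectionForm g x v (X x) := by
  simp [nablaAt]

theorem clmTrace_add (A B : E →L[ℝ] E) : clmTrace (A + B) = clmTrace A + clmTrace B := by
  simp [clmTrace]

theorem clmTrace_sub (A B : E →L[ℝ] E) : clmTrace (A - B) = clmTrace A - clmTrace B := by
  simp [clmTrace]

theorem clmTrace_smul (c : ℝ) (A : E →L[ℝ] E) : clmTrace (c • A) = c * clmTrace A := by
  simp [clmTrace]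

variable [FiniteDimensional ℝ E]

theorem clmTrace_comp_comm (A B : E →L[ℝ] E) : clmTrace (A ∘L B) = clmTrace (B ∘L A) := by
  simpa [clmTrace] using LinearMap.trace_comp_comm' (B : E →ₗ[ℝ] E) (A : E →ₗ[ℝ] E)

theorem clmTrace_smulRight (l : E →L[ℝ] ℝ) (v : E) : clmTrace (l.smulRight v) = l v := by
  simp [clmTrace]

/-- The trace as a continuous linear functional. -/
noncomputable def clmTraceL : (E →L[ℝ] E) →L[ℝ] ℝ :=
  LinearMap.toContinuousLinearMap
    { toFun := clmTrace, map_add' := clmTrace_add, map_smul' := clmTrace_smul }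

namespace SmoothMetricOn

variable {Ω : Set E} {g : E → E →L[ℝ] E →L[ℝ] ℝ} (hg : SmoothMetricOn Ω g) {x : E}
  {f a b : E → ℝ} {X Y : E → E}

include hg

theorem mono {Ω' : Set E} (h : Ω' ⊆ Ω) (ho : IsOpen Ω') : SmoothMetricOn Ω' g :=
  ⟨ho, hg.contDiffOn.mono h, fun x hx => hg.symm x (h hx), fun x hx => hg.pos x (h hx)⟩

/-- Positivity gives injectivity, and the dual has the same dimension. Hence on `Ω` the total
function `inverse` in `sharpAt` takes a genuine inverse, not its default value zero. -/
theorem isInvertible (hx : x ∈ Ω) : (g x).IsInvertible := by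
  have hinj : Function.Injective (g x : E →ₗ[ℝ] (E →L[ℝ] ℝ)) := by
    rw [← LinearMap.ker_eq_bot, LinearMap.ker_eq_bot']
    intro v hv
    by_contra h0
    have := hg.pos x hx v h0
    rw [show g x v = 0 from hv] at this
    simp at this
  have hd : Module.finrank ℝ E = Module.finrank ℝ (E →L[ℝ] ℝ) := by
    rw [← (LinearMap.toContinuousLinearMap : (E →ₗ[ℝ] ℝ) ≃ₗ[ℝ] (E →L[ℝ] ℝ)).finrank_eq]
    exact (Subspace.dual_finrank_eq (K := ℝ) (V := E)).symm
  exact ⟨(LinearEquiv.ofInjectiveOfFinrankEq _ hinj hd).toContinuousLinearEquiv, by ext; rfl⟩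

theorem apply_sharpAt (hx : x ∈ Ω) (l : E →L[ℝ] ℝ) (v : E) : g x (sharpAt g x l) v = l v := by
  rw [sharpAt, (hg.isInvertible hx).self_apply_inverse]

theorem ext_apply (hx : x ∈ Ω) {v w : E} (h : ∀ z, g x v z = g x w z) : v = w := by
  have h2 : g x v = g x w := by ext z; exact h z
  obtain ⟨e, he⟩ := hg.isInvertible hx
  rw [← he] at h2
  exact e.injective h2

theorem contDiffOn_sharpAt : ContDiffOn ℝ ∞ (sharpAt g) Ω := by
  have : CompleteSpace E := FiniteDimensional.complete ℝ E
  intro x hx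
  exact ((hg.isInvertible hx).contDiffAt_map_inverse).comp_contDiffWithinAt x (hg.contDiffOn x hx)

theorem contDiffOn_fderiv {F : Type*} [NormedAddCommGroup F] [NormedSpace ℝ F] {f : E → F}
    (hf : ContDiffOn ℝ ∞ f Ω) : ContDiffOn ℝ ∞ (fderiv ℝ f) Ω :=
  hf.fderiv_of_isOpen hg.isOpen (by simp)

theorem contDiffAt {F : Type*} [NormedAddCommGroup F] [NormedSpace ℝ F] {f : E → F}
    (hf : ContDiffOn ℝ ∞ f Ω) (hx : x ∈ Ω) : ContDiffAt ℝ ∞ f x :=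
  hf.contDiffAt (hg.isOpen.mem_nhds hx)

theorem differentiableAt {F : Type*} [NormedAddCommGroup F] [NormedSpace ℝ F] {f : E → F}
    (hf : ContDiffOn ℝ ∞ f Ω) (hx : x ∈ Ω) : DifferentiableAt ℝ f x :=
  (hg.contDiffAt hf hx).differentiableAt (by simp)

theorem contDiffOn_connectionForm : ContDiffOn ℝ ∞ (connectionForm g) Ω := by
  have h := hg.contDiffOn_fderiv hg.contDiffOn
  have h2 : ContDiffOn ℝ ∞ (fun x => (fderiv ℝ g x).flip) Ω :=
    (ContinuousLinearMap.flipₗᵢ ℝ E E (E →L[ℝ] ℝ)).contDiff.comp_contDiffOn h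
  have h3 : ContDiffOn ℝ ∞ (koszulForm g) Ω :=
    (h.add h2).sub (contDiffOn_const.clm_comp h2)
  have h4 := (ContinuousLinearMap.compL ℝ E (E →L[ℝ] ℝ) E).contDiff.comp_contDiffOn
    hg.contDiffOn_sharpAt
  exact h4.clm_comp (h3.const_smul (1 / 2 : ℝ))

theorem contDiffOn_gradAt (hf : ContDiffOn ℝ ∞ f Ω) : ContDiffOn ℝ ∞ (gradAt g f) Ω :=
  hg.contDiffOn_sharpAt.clm_apply (hg.contDiffOn_fderiv hf)

theorem contDiffOn_nablaAt (hX : ContDiffOn ℝ ∞ X Ω) : ContDiffOn ℝ ∞ (nablaAt g X) Ω := by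
  refine (hg.contDiffOn_fderiv hX).add (ContDiffOn.clm_apply ?_ hX)
  exact (ContinuousLinearMap.flipₗᵢ ℝ E E E).contDiff.comp_contDiffOn hg.contDiffOn_connectionForm

theorem contDiffOn_hessAt (hf : ContDiffOn ℝ ∞ f Ω) : ContDiffOn ℝ ∞ (hessAt g f) Ω :=
  hg.contDiffOn_nablaAt (hg.contDiffOn_gradAt hf)

theorem contDiffOn_inner (hX : ContDiffOn ℝ ∞ X Ω) (hY : ContDiffOn ℝ ∞ Y Ω) :
    ContDiffOn ℝ ∞ (fun y => g y (X y) (Y y)) Ω :=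
  (hg.contDiffOn.clm_apply hX).clm_apply hY

theorem apply_connectionForm (hx : x ∈ Ω) (v w z : E) :
    g x (connectionForm g x v w) z = (1 / 2) * koszulForm g x v w z := by
  have : connectionForm g x v w = sharpAt g x ((1 / 2 : ℝ) • koszulForm g x v w) := by
    simp [connectionForm]
  rw [this, hg.apply_sharpAt hx]
  simp

theorem fderiv_metric_symm (hx : x ∈ Ω) (v w z : E) :
    fderiv ℝ g x v w z = fderiv ℝ g x v z w := by
  have hd := hg.differentiableAt hg.contDiffOn hx
  have h1 : ∀ w z, fderiv ℝ (fun y => g y w z) x v = fderiv ℝ g x v w z := by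
    intro w z
    rw [fderiv_clm_apply (hd.clm_apply (differentiableAt_const w)) (differentiableAt_const z),
      fderiv_clm_apply hd (differentiableAt_const w)]
    simp
  rw [← h1, ← h1]
  refine congrArg (fun L : E →L[ℝ] ℝ => L v) (Filter.EventuallyEq.fderiv_eq ?_)
  filter_upwards [hg.isOpen.mem_nhds hx] with y hy using hg.symm y hy w z

/-- Torsion-freeness: the Koszul expression is symmetric in its first two slots once the derivative
of the metric is symmetric in its last two. -/
theorem connectionForm_symm (hx : x ∈ Ω) (v w : E) :
    connectionForm g x v w = connectionForm g x w v := by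
  refine hg.ext_apply hx fun z => ?_
  rw [hg.apply_connectionForm hx, hg.apply_connectionForm hx, koszulForm_apply, koszulForm_apply,
    hg.fderiv_metric_symm hx z v w]
  ring

/-- Adding the Koszul expressions with `w` and `z` exchanged cancels everything but twice the
derivative along `v`. This is metric compatibility for constant fields. -/
theorem fderiv_metric (hx : x ∈ Ω) (v w z : E) :
    fderiv ℝ g x v w z = g x (connectionForm g x v w) z + g x w (connectionForm g x v z) := by
  rw [hg.symm x hx w, hg.apply_connectionForm hx, hg.apply_connectionForm hx, koszulForm_apply,
    koszulForm_apply, hg.fderiv_metric_symm hx v z w, hg.fderiv_metric_symm hx w v z,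
    hg.fderiv_metric_symm hx z v w]
  ring

/-- Metric compatibility. -/
theorem fderiv_inner (hx : x ∈ Ω) (hX : DifferentiableAt ℝ X x) (hY : DifferentiableAt ℝ Y x)
    (v : E) :
    fderiv ℝ (fun y => g y (X y) (Y y)) x v =
      g x (nablaAt g X x v) (Y x) + g x (X x) (nablaAt g Y x v) := by
  have hd := hg.differentiableAt hg.contDiffOn hx
  rw [fderiv_clm_apply (hd.clm_apply hX) hY, fderiv_clm_apply hd hX]
  simp [nablaAt_apply, hg.fderiv_metric hx]
  ring

theorem apply_gradAt (hx : x ∈ Ω) (v : E) : g x (gradAt g f x) v = fderiv ℝ f x v :=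
  hg.apply_sharpAt hx _ _

/-- Differentiate `⟪∇f, w⟫ = df(w)` along `v` with `w` constant; the covariant derivative of `w` is
then a pure Christoffel term. This links the endomorphism to the classical coordinate formula. -/
theorem apply_hessAt (hx : x ∈ Ω) (hf : ContDiffOn ℝ ∞ f Ω) (v w : E) :
    g x (hessAt g f x v) w =
      fderiv ℝ (fderiv ℝ f) x v w - fderiv ℝ f x (connectionForm g x v w) := by
  have h1 := hg.fderiv_inner hx (hg.differentiableAt (hg.contDiffOn_gradAt hf) hx)
    (differentiableAt_const w) v
  have h2 : fderiv ℝ (fun y => g y (gradAt g f y) w) x v = fderiv ℝ (fderiv ℝ f) x v w := by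
    have : (fun y => g y (gradAt g f y) w) =ᶠ[nhds x] fun y => fderiv ℝ f y w := by
      filter_upwards [hg.isOpen.mem_nhds hx] with y hy using hg.apply_gradAt hy w
    rw [this.fderiv_eq, fderiv_clm_apply (hg.differentiableAt (hg.contDiffOn_fderiv hf) hx)
      (differentiableAt_const w)]
    simp
  rw [h2] at h1
  rw [h1, ← hg.apply_gradAt hx (f := f), hessAt]
  simp [nablaAt_apply]

theorem fderiv_fderiv_symm {F : Type*} [NormedAddCommGroup F] [NormedSpace ℝ F] {f : E → F}
    (hx : x ∈ Ω) (hf : ContDiffOn ℝ ∞ f Ω) (v w : E) :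
    fderiv ℝ (fderiv ℝ f) x v w = fderiv ℝ (fderiv ℝ f) x w v :=
  (hg.contDiffAt hf hx).isSymmSndFDerivAt (by simp; exact WithTop.coe_le_coe.2 le_top) v w

theorem hessAt_symm (hx : x ∈ Ω) (hf : ContDiffOn ℝ ∞ f Ω) (v w : E) :
    g x (hessAt g f x v) w = g x v (hessAt g f x w) := by
  rw [hg.symm x hx v, hg.apply_hessAt hx hf, hg.apply_hessAt hx hf, hg.fderiv_fderiv_symm hx hf,
    hg.connectionForm_symm hx]

/-- The Hessian on gradient fields, through gradients and inner products only. -/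
theorem two_mul_hessAt_gradAt (hx : x ∈ Ω) (hf : ContDiffOn ℝ ∞ f Ω) (ha : ContDiffOn ℝ ∞ a Ω)
    (hb : ContDiffOn ℝ ∞ b Ω) :
    2 * g x (hessAt g f x (gradAt g a x)) (gradAt g b x) =
      fderiv ℝ (fun y => g y (gradAt g f y) (gradAt g b y)) x (gradAt g a x)
      + fderiv ℝ (fun y => g y (gradAt g f y) (gradAt g a y)) x (gradAt g b x)
      - fderiv ℝ (fun y => g y (gradAt g a y) (gradAt g b y)) x (gradAt g f x) := by
  have df := hg.differentiableAt (hg.contDiffOn_gradAt hf) hx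
  have da := hg.differentiableAt (hg.contDiffOn_gradAt ha) hx
  have db := hg.differentiableAt (hg.contDiffOn_gradAt hb) hx
  rw [hg.fderiv_inner hx df db, hg.fderiv_inner hx df da, hg.fderiv_inner hx da db]
  change _ = g x (hessAt g f x _) _ + g x _ (hessAt g b x _) +
    (g x (hessAt g f x _) _ + g x _ (hessAt g a x _)) -
    (g x (hessAt g a x _) _ + g x _ (hessAt g b x _))
  rw [← hg.hessAt_symm hx ha, ← hg.hessAt_symm hx hb, ← hg.hessAt_symm hx hb,
    hg.hessAt_symm hx hf (gradAt g b x), hg.symm x hx (gradAt g b x) (hessAt g f x (gradAt g a x)),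
    hg.symm x hx (hessAt g a x (gradAt g f x))]
  rw [hg.symm x hx (gradAt g b x), hg.hessAt_symm hx hb (gradAt g f x),
    hg.symm x hx _ (hessAt g b x (gradAt g a x))]
  ring

theorem gradAt_normSq (hx : x ∈ Ω) (hf : ContDiffOn ℝ ∞ f Ω) :
    gradAt g (fun y => g y (gradAt g f y) (gradAt g f y)) x =
      (2 : ℝ) • hessAt g f x (gradAt g f x) := by
  refine hg.ext_apply hx fun z => ?_
  have df := hg.differentiableAt (hg.contDiffOn_gradAt hf) hx
  rw [hg.apply_gradAt hx, hg.fderiv_inner hx df df, hg.symm x hx (gradAt g f x)]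
  change g x (hessAt g f x z) _ + g x (hessAt g f x z) _ = _
  rw [hg.hessAt_symm hx hf, hg.symm x hx z]
  simp
  ring

/-- Bochner's formula. -/
theorem trace_nablaAt_hessAt_gradAt (hx : x ∈ Ω) (hf : ContDiffOn ℝ ∞ f Ω) :
    clmTrace (nablaAt g (fun y => hessAt g f y (gradAt g f y)) x) =
      clmTrace (hessAt g f x ∘L hessAt g f x)
        + clmTrace (curvEndo g x (gradAt g f x) (gradAt g f x))
        + fderiv ℝ (fun y => clmTrace (hessAt g f y)) x (gradAt g f x) := by
  have dV := hg.differentiableAt (hg.contDiffOn_gradAt hf) hx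
  have dV' := hg.differentiableAt (hg.contDiffOn_fderiv (hg.contDiffOn_gradAt hf)) hx
  have dA := hg.differentiableAt (hg.contDiffOn_hessAt hf) hx
  have dΓ := hg.differentiableAt hg.contDiffOn_connectionForm hx
  set V := gradAt g f with hV
  set A := hessAt g f with hA
  set Γ := connectionForm g with hΓ
  have hAx : ∀ v, A x v = fderiv ℝ V x v + Γ x v (V x) := fun v => nablaAt_apply _ _ _ _
  have hdA : ∀ v z, fderiv ℝ A x v z = fderiv ℝ (fderiv ℝ V) x v z + fderiv ℝ Γ x v z (V x)
      + Γ x z (fderiv ℝ V x v) := by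
    intro v z
    have h1 : fderiv ℝ (fun y => A y z) x v = fderiv ℝ A x v z := by
      rw [fderiv_clm_apply dA (differentiableAt_const z)]; simp
    have h2 : (fun y => A y z) = fun y => fderiv ℝ V y z + Γ y z (V y) := by
      ext1 y; exact nablaAt_apply _ _ _ _
    have dz := dΓ.clm_apply (differentiableAt_const z)
    rw [← h1, h2, fderiv_fun_add (dV'.clm_apply (differentiableAt_const z)) (dz.clm_apply dV),
      fderiv_clm_apply dV' (differentiableAt_const z), fderiv_clm_apply dz dV,
      fderiv_clm_apply dΓ (differentiableAt_const z)]
    simp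
    abel
  -- The last two groups together are the covariant derivative of `A` along `V = ∇f`: the coordinate
  -- derivative plus a commutator with the Christoffel map. The commutator has trace zero, so only
  -- the derivative of `tr A` survives.
  have key : nablaAt g (fun y => A y (V y)) x =
      A x ∘L A x + curvEndo g x (V x) (V x) + fderiv ℝ A x (V x)
        + (Γ x (V x) ∘L A x - A x ∘L Γ x (V x)) := by
    ext v
    rw [nablaAt_apply, fderiv_clm_apply dA dV]
    simp only [add_apply, sub_apply,
      ContinuousLinearMap.comp_apply, ContinuousLinearMap.flip_apply, curvEndo_apply, hdA]
    rw [hg.fderiv_fderiv_symm hx (hg.contDiffOn_gradAt hf) (V x) v]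
    have e2 : A x (fderiv ℝ V x v) = A x (A x v) - A x (Γ x (V x) v) := by
      rw [hAx v, map_add, hg.connectionForm_symm hx v (V x)]; abel
    rw [← hΓ, e2, hAx (V x), map_add, hAx v, map_add (Γ x (V x)), map_add (A x), ← hV]
    abel
  have htr : fderiv ℝ (fun y => clmTrace (A y)) x (V x) = clmTrace (fderiv ℝ A x (V x)) := by
    have h := (clmTraceL (E := E)).hasFDerivAt.comp x dA.hasFDerivAt
    have h2 : fderiv ℝ (fun y => clmTrace (A y)) x = clmTraceL ∘L fderiv ℝ A x := h.fderiv
    rw [h2]; rfl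
  rw [key, htr, clmTrace_add, clmTrace_add, clmTrace_add, clmTrace_sub,
    clmTrace_comp_comm (Γ x (V x)), sub_self, add_zero]

theorem nablaAt_smul {h : E → ℝ} (hh : DifferentiableAt ℝ h x) (hX : DifferentiableAt ℝ X x) :
    nablaAt g (fun y => h y • X y) x = h x • nablaAt g X x + (fderiv ℝ h x).smulRight (X x) := by
  ext v
  rw [nablaAt_apply, fderiv_fun_smul hh hX]
  simp [nablaAt_apply]
  abel

end SmoothMetricOn

end LocalRiemannian

/-! ### The local expressions of the geometry of a Riemannian manifold -/

section Charts

set_option linter.unusedSectionVars false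
set_option maxSynthPendingDepth 3

open scoped RealInnerProductSpace

variable (n : ℕ) {M : Type*} [TopologicalSpace M] [ChartedSpace (EuclideanSpace ℝ (Fin n)) M]
  [IsManifold (𝓡 n) ∞ M]

/-- The components of a tangent vector at `q` in the chart at `c`. -/
noncomputable def toCoord (c q : M) :
    TangentSpace (𝓡 n) q →L[ℝ] EuclideanSpace ℝ (Fin n) :=
  (trivializationAt (EuclideanSpace ℝ (Fin n)) (TangentSpace (𝓡 n)) c).continuousLinearMapAt ℝ q

/-- The tangent vector at `q` with given components in the chart at `c`. -/
noncomputable def ofCoord (c q : M) :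
    EuclideanSpace ℝ (Fin n) →L[ℝ] TangentSpace (𝓡 n) q :=
  (trivializationAt (EuclideanSpace ℝ (Fin n)) (TangentSpace (𝓡 n)) c).symmL ℝ q

/-- The image in the chart at `c` of a subset of `M`. -/
def chartImage (c : M) (W : Set M) : Set (EuclideanSpace ℝ (Fin n)) :=
  (extChartAt (𝓡 n) c).target ∩ (extChartAt (𝓡 n) c).symm ⁻¹' W

variable {n} {c q : M} {W : Set M} {f a b : M → ℝ}

theorem mem_baseSet (hq : q ∈ (extChartAt (𝓡 n) c).source) :
    q ∈ (trivializationAt (EuclideanSpace ℝ (Fin n)) (TangentSpace (𝓡 n)) c).baseSet := by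
  rwa [TangentBundle.trivializationAt_baseSet, ← extChartAt_source (𝓡 n)]

theorem ofCoord_toCoord (hq : q ∈ (extChartAt (𝓡 n) c).source) (v : TangentSpace (𝓡 n) q) :
    ofCoord n c q (toCoord n c q v) = v :=
  Trivialization.symmL_continuousLinearMapAt _ (mem_baseSet hq) v

theorem toCoord_ofCoord (hq : q ∈ (extChartAt (𝓡 n) c).source) (v : EuclideanSpace ℝ (Fin n)) :
    toCoord n c q (ofCoord n c q v) = v :=
  Trivialization.continuousLinearMapAt_symmL _ (mem_baseSet hq) v

theorem isOpen_chartImage (hW : IsOpen W) : IsOpen (chartImage n c W) :=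
  (continuousOn_extChartAt_symm c).isOpen_inter_preimage (isOpen_extChartAt_target c) hW

theorem mem_chartImage (hq : q ∈ (extChartAt (𝓡 n) c).source) (hW : q ∈ W) :
    extChartAt (𝓡 n) c q ∈ chartImage n c W :=
  ⟨(extChartAt (𝓡 n) c).map_source hq, by
    rwa [Set.mem_preimage, (extChartAt (𝓡 n) c).left_inv hq]⟩

theorem chartRead_extChartAt (hq : q ∈ (extChartAt (𝓡 n) c).source) :
    chartRead n c f (extChartAt (𝓡 n) c q) = f q := by
  rw [chartRead, (extChartAt (𝓡 n) c).left_inv hq]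

theorem contDiffOn_chartRead (hf : ContMDiffOn (𝓡 n) 𝓘(ℝ, ℝ) ∞ f W) :
    ContDiffOn ℝ ∞ (chartRead n c f) (chartImage n c W) := by
  rw [← contMDiffOn_iff_contDiffOn]
  exact hf.comp ((contMDiffOn_extChartAt_symm c).mono Set.inter_subset_left)
    Set.inter_subset_right

theorem eventuallyEq_chartRead_comp (hq : q ∈ (extChartAt (𝓡 n) c).source) :
    f =ᶠ[nhds q] chartRead n c f ∘ extChartAt (𝓡 n) c := by
  filter_upwards [(isOpen_extChartAt_source c).mem_nhds hq] with y hy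
  exact (chartRead_extChartAt hy).symm

theorem contMDiffAt_of_chartRead (hq : q ∈ (extChartAt (𝓡 n) c).source)
    (hf : ContDiffAt ℝ ∞ (chartRead n c f) (extChartAt (𝓡 n) c q)) :
    ContMDiffAt (𝓡 n) 𝓘(ℝ, ℝ) ∞ f q := by
  refine ContMDiffAt.congr_of_eventuallyEq ?_ (eventuallyEq_chartRead_comp hq)
  exact hf.contMDiffAt.comp q (contMDiffAt_extChartAt' (by rwa [← extChartAt_source (𝓡 n)]))

/-- The tangent trivialization at `c` acts over the chart domain as the derivative of the chart, so
this is the chain rule for `f` written as its chart reading after the chart. -/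
theorem mvfderiv_eq_fderiv_chartRead (hq : q ∈ (extChartAt (𝓡 n) c).source)
    (hf : DifferentiableAt ℝ (chartRead n c f) (extChartAt (𝓡 n) c q))
    (v : TangentSpace (𝓡 n) q) :
    mvfderiv (𝓡 n) f q v =
      fderiv ℝ (chartRead n c f) (extChartAt (𝓡 n) c q) (toCoord n c q v) := by
  have hq' : q ∈ (chartAt (EuclideanSpace ℝ (Fin n)) c).source := by
    rwa [← extChartAt_source (𝓡 n)]
  have h1 : mfderiv (𝓡 n) 𝓘(ℝ, ℝ) f q =
      (mfderiv 𝓘(ℝ, EuclideanSpace ℝ (Fin n)) 𝓘(ℝ, ℝ) (chartRead n c f) (extChartAt (𝓡 n) c q)).comp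
        (mfderiv (𝓡 n) 𝓘(ℝ, EuclideanSpace ℝ (Fin n)) (extChartAt (𝓡 n) c) q) := by
    rw [(eventuallyEq_chartRead_comp hq).mfderiv_eq]
    exact mfderiv_comp q hf.mdifferentiableAt (mdifferentiableAt_extChartAt hq')
  rw [mvfderiv, toCoord, TangentBundle.continuousLinearMapAt_trivializationAt hq']
  rw [mfderiv_eq_fderiv] at h1
  exact congrArg (fun L => L v) h1

theorem formOfCoeff_apply (p : M) (t : Fin n → Fin n → ℝ) (v w : TangentSpace (𝓡 n) p) :
    formOfCoeff n p t v w = ∑ i, ∑ j, t i j * (toCoord n p p v i * toCoord n p p w j) := by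
  simp [formOfCoeff, coordForm, toCoord]

end Charts

/-! ### Expansions in the standard basis. -/

section CoordinateSums

set_option linter.unusedSectionVars false
set_option maxSynthPendingDepth 3

variable {n : ℕ}

theorem eq_sum_smul_single (v : EuclideanSpace ℝ (Fin n)) :
    v = ∑ i, v i • EuclideanSpace.single i (1 : ℝ) := by
  ext j
  simp [Finset.sum_apply, Pi.single_apply]

theorem clm_apply_eq_sum {F : Type*} [NormedAddCommGroup F] [NormedSpace ℝ F]
    (T : EuclideanSpace ℝ (Fin n) →L[ℝ] F) (v : EuclideanSpace ℝ (Fin n)) :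
    T v = ∑ i, v i • T (EuclideanSpace.single i 1) := by
  conv_lhs => rw [eq_sum_smul_single v]
  simp

theorem clm_apply₂_eq_sum
    (T : EuclideanSpace ℝ (Fin n) →L[ℝ] EuclideanSpace ℝ (Fin n) →L[ℝ] ℝ)
    (v w : EuclideanSpace ℝ (Fin n)) :
    T v w = ∑ i, ∑ j, T (EuclideanSpace.single i 1) (EuclideanSpace.single j 1) * (v i * w j) := by
  rw [clm_apply_eq_sum T v]
  simp only [sum_apply, smul_apply, smul_eq_mul]
  refine Finset.sum_congr rfl fun i _ => ?_
  rw [clm_apply_eq_sum (T _) w, Finset.mul_sum]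
  exact Finset.sum_congr rfl fun j _ => by rw [smul_eq_mul]; ring

theorem clmTrace_eq_sum (A : EuclideanSpace ℝ (Fin n) →L[ℝ] EuclideanSpace ℝ (Fin n)) :
    clmTrace A = ∑ i, A (EuclideanSpace.single i 1) i := by
  rw [clmTrace, LinearMap.trace_eq_sum_inner _ (EuclideanSpace.basisFun (Fin n) ℝ)]
  simp [EuclideanSpace.inner_single_left]

end CoordinateSums

/-! ### The metric in a chart, and the coordinate formulas for connection, Hessian and Ricci tensor.
-/

section ChartMetric

set_option linter.unusedSectionVars false
set_option maxSynthPendingDepth 3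

open scoped RealInnerProductSpace

variable (n : ℕ) {M : Type*} [TopologicalSpace M] [ChartedSpace (EuclideanSpace ℝ (Fin n)) M]
  [IsManifold (𝓡 n) ∞ M]
  [RiemannianBundle (fun x : M => TangentSpace (𝓡 n) x)]

/-- The metric in the chart at `c`. -/
noncomputable def chartMetric (c : M) (y : EuclideanSpace ℝ (Fin n)) :
    EuclideanSpace ℝ (Fin n) →L[ℝ] EuclideanSpace ℝ (Fin n) →L[ℝ] ℝ :=
  (innerForm (V := TangentSpace (𝓡 n) ((extChartAt (𝓡 n) c).symm y))).bilinearComp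
    (ofCoord n c ((extChartAt (𝓡 n) c).symm y)) (ofCoord n c ((extChartAt (𝓡 n) c).symm y))

variable {n} {c q : M} {W : Set M} {f a b : M → ℝ}

theorem chartMetric_apply (y v w : EuclideanSpace ℝ (Fin n)) :
    chartMetric n c y v w =
      ⟪ofCoord n c ((extChartAt (𝓡 n) c).symm y) v,
        ofCoord n c ((extChartAt (𝓡 n) c).symm y) w⟫ := rfl

theorem chartMetric_toCoord (hq : q ∈ (extChartAt (𝓡 n) c).source) (v w : TangentSpace (𝓡 n) q) :
    chartMetric n c (extChartAt (𝓡 n) c q) (toCoord n c q v) (toCoord n c q w) = ⟪v, w⟫ := by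
  -- The chart's inverse returns to `q` only propositionally, so the fibre is changed by
  -- generalizing the base point.
  have h : ∀ q', q' = q → ∀ x y : EuclideanSpace ℝ (Fin n),
      ⟪ofCoord n c q' x, ofCoord n c q' y⟫ = ⟪ofCoord n c q x, ofCoord n c q y⟫ := by
    rintro _ rfl _ _; rfl
  rw [chartMetric_apply, h _ ((extChartAt (𝓡 n) c).left_inv hq), ofCoord_toCoord hq,
    ofCoord_toCoord hq]

theorem metricCoeff_eq (y : EuclideanSpace ℝ (Fin n)) (i j : Fin n) :
    metricCoeff n c y i j =
      chartMetric n c y (EuclideanSpace.single i 1) (EuclideanSpace.single j 1) := rfl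

section Smooth

variable [IsContMDiffRiemannianBundle (𝓡 n) ∞ (EuclideanSpace ℝ (Fin n))
      (fun x : M => TangentSpace (𝓡 n) x)]

/-- Coordinate fields are constant in the trivialization, hence smooth, and the bundle metric pairs
smooth sections smoothly. Positivity follows from injectivity of `ofCoord` over the chart domain. -/
theorem smoothMetricOn_chartMetric (c : M) :
    SmoothMetricOn (extChartAt (𝓡 n) c).target (chartMetric n c) where
  isOpen := isOpen_extChartAt_target c
  contDiffOn := by
    have hsec : ∀ v : EuclideanSpace ℝ (Fin n), ContMDiffOn (𝓡 n)
        ((𝓡 n).prod 𝓘(ℝ, EuclideanSpace ℝ (Fin n))) ∞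
        (fun q : M => TotalSpace.mk' (EuclideanSpace ℝ (Fin n)) q (ofCoord n c q v))
        (extChartAt (𝓡 n) c).source := by
      intro v
      have hb : (extChartAt (𝓡 n) c).source = (trivializationAt (EuclideanSpace ℝ (Fin n))
          (TangentSpace (𝓡 n)) c).baseSet := by
        rw [TangentBundle.trivializationAt_baseSet, ← extChartAt_source (𝓡 n)]
      rw [hb, Trivialization.contMDiffOn_section_baseSet_iff]
      refine (contMDiffOn_const (c := v)).congr fun q hq => ?_
      rw [← Trivialization.continuousLinearMapAt_apply_of_mem (R := ℝ) _ hq]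
      exact toCoord_ofCoord (by rwa [hb]) v
    rw [contDiffOn_clm_apply]
    intro v
    rw [contDiffOn_clm_apply]
    intro w
    exact contDiffOn_chartRead (W := (extChartAt (𝓡 n) c).source)
      (ContMDiffOn.inner_bundle (hsec v) (hsec w)) |>.mono
      fun y hy => ⟨hy, (extChartAt (𝓡 n) c).map_target hy⟩
  symm := fun y hy v w => by rw [chartMetric_apply, chartMetric_apply, real_inner_comm]
  pos := fun y hy v hv => by
    rw [chartMetric_apply]
    refine real_inner_self_pos.2 fun h => hv ?_
    rw [← toCoord_ofCoord ((extChartAt (𝓡 n) c).map_target hy) v, h, map_zero]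

theorem smoothMetricOn_chartImage (c : M) (hW : IsOpen W) :
    SmoothMetricOn (chartImage n c W) (chartMetric n c) :=
  (smoothMetricOn_chartMetric c).mono Set.inter_subset_left (isOpen_chartImage hW)

theorem partialD_metricCoeff {y : EuclideanSpace ℝ (Fin n)} (hy : y ∈ (extChartAt (𝓡 n) c).target)
    (i j k : Fin n) :
    partialD i (fun z => metricCoeff n c z j k) y =
      fderiv ℝ (chartMetric n c) y (EuclideanSpace.single i 1) (EuclideanSpace.single j 1)
        (EuclideanSpace.single k 1) := by
  have hg := smoothMetricOn_chartMetric (n := n) c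
  have hd := hg.differentiableAt hg.contDiffOn hy
  simp only [metricCoeff_eq, partialD]
  rw [fderiv_clm_apply (hd.clm_apply (differentiableAt_const _)) (differentiableAt_const _),
    fderiv_clm_apply hd (differentiableAt_const _)]
  simp

/-- The metric matrix applied to the components of `connectionForm` gives half the Koszul
expression. Nondegeneracy makes that matrix invertible, and multiplying by its inverse yields the
classical formula. -/
theorem christoffel_eq {y : EuclideanSpace ℝ (Fin n)} (hy : y ∈ (extChartAt (𝓡 n) c).target)
    (k i j : Fin n) :
    christoffel n c k i j y = connectionForm (chartMetric n c) y (EuclideanSpace.single i 1)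
      (EuclideanSpace.single j 1) k := by
  have hg := smoothMetricOn_chartMetric (n := n) c
  set G := metricCoeff n c y with hG
  have hmul : ∀ x : EuclideanSpace ℝ (Fin n), ∀ l,
      G.mulVec x.ofLp l = chartMetric n c y x (EuclideanSpace.single l 1) := by
    intro x l
    rw [hg.symm y hy, clm_apply_eq_sum (chartMetric n c y _) x]
    simp [Matrix.mulVec, dotProduct, hG, metricCoeff_eq, mul_comm]
  have hunit : IsUnit G := by
    rw [← Matrix.mulVec_injective_iff_isUnit, ← Matrix.coe_mulVecLin,
      ← LinearMap.ker_eq_bot, LinearMap.ker_eq_bot']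
    intro x hx
    have : WithLp.toLp 2 x = (0 : EuclideanSpace ℝ (Fin n)) := by
      refine hg.ext_apply hy fun z => ?_
      rw [clm_apply_eq_sum (chartMetric n c y _) z, map_zero]
      refine (Finset.sum_eq_zero fun l _ => ?_).trans (by simp)
      rw [← hmul, show G.mulVec x = 0 from hx]
      simp
    simpa using congrArg WithLp.ofLp this
  set X := connectionForm (chartMetric n c) y (EuclideanSpace.single i 1)
      (EuclideanSpace.single j 1) with hX
  have hinv : G⁻¹.mulVec (G.mulVec X.ofLp) = X.ofLp := by
    rw [Matrix.mulVec_mulVec, Matrix.nonsing_inv_mul _ ((Matrix.isUnit_iff_isUnit_det _).1 hunit),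
      Matrix.one_mulVec]
  rw [← hinv, Matrix.mulVec, dotProduct, christoffel, Finset.mul_sum]
  refine Finset.sum_congr rfl fun l _ => ?_
  rw [hmul, hX, hg.apply_connectionForm hy, koszulForm_apply, partialD_metricCoeff hy,
    partialD_metricCoeff hy, partialD_metricCoeff hy]
  ring

theorem hessian_apply (p : M) (hW : IsOpen W) (hp : p ∈ W)
    (hf : ContMDiffOn (𝓡 n) 𝓘(ℝ, ℝ) ∞ f W) (v w : TangentSpace (𝓡 n) p) :
    hessian n f p v w =
      chartMetric n p (extChartAt (𝓡 n) p p)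
        (hessAt (chartMetric n p) (chartRead n p f) (extChartAt (𝓡 n) p p) (toCoord n p p v))
        (toCoord n p p w) := by
  have hg := smoothMetricOn_chartImage (n := n) p hW
  have hy : extChartAt (𝓡 n) p p ∈ chartImage n p W :=
    mem_chartImage (mem_extChartAt_source p) hp
  have hF := contDiffOn_chartRead (c := p) hf
  rw [hg.apply_hessAt hy hF]
  set y := extChartAt (𝓡 n) p p
  set F := chartRead n p f
  -- The Hessian as one bilinear form in coordinates, so that it can be compared with `hessian`
  -- coefficient by coefficient.
  have e := clm_apply₂_eq_sum (fderiv ℝ (fderiv ℝ F) y -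
    (ContinuousLinearMap.compL ℝ _ _ _ (fderiv ℝ F y)) ∘L connectionForm (chartMetric n p) y)
    (toCoord n p p v) (toCoord n p p w)
  simp only [sub_apply, ContinuousLinearMap.comp_apply,
    ContinuousLinearMap.compL_apply] at e
  rw [e, hessian, formOfCoeff_apply]
  refine Finset.sum_congr rfl fun i _ => Finset.sum_congr rfl fun j _ => ?_
  congr 2
  · rw [partialD, show partialD j F = fun z => fderiv ℝ F z (EuclideanSpace.single j 1) from rfl,
      fderiv_clm_apply (hg.differentiableAt (hg.contDiffOn_fderiv hF) hy)
      (differentiableAt_const _)]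
    simp
  · rw [clm_apply_eq_sum (fderiv ℝ F y)]
    exact Finset.sum_congr rfl fun k _ => by rw [christoffel_eq hy.1]; rfl

theorem toCoord_covDeriv (X : (q : M) → TangentSpace (𝓡 n) q) (p : M)
    (hX : DifferentiableAt ℝ (fun y => toCoord n p ((extChartAt (𝓡 n) p).symm y)
      (X ((extChartAt (𝓡 n) p).symm y))) (extChartAt (𝓡 n) p p)) (v : TangentSpace (𝓡 n) p) :
    toCoord n p p (covDeriv n X p v) =
      nablaAt (chartMetric n p) (fun y => toCoord n p ((extChartAt (𝓡 n) p).symm y)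
        (X ((extChartAt (𝓡 n) p).symm y))) (extChartAt (𝓡 n) p p) (toCoord n p p v) := by
  have hp := mem_extChartAt_source (I := 𝓡 n) p
  have hy := mem_extChartAt_target (I := 𝓡 n) p
  set Y : EuclideanSpace ℝ (Fin n) → EuclideanSpace ℝ (Fin n) :=
    fun y => toCoord n p ((extChartAt (𝓡 n) p).symm y) (X ((extChartAt (𝓡 n) p).symm y)) with hY
  set y := extChartAt (𝓡 n) p p with hyy
  have hYy : Y y = toCoord n p p (X p) := by
    have h : ∀ q', q' = p → toCoord n p q' (X q') = toCoord n p p (X p) := by rintro _ rfl; rfl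
    exact h _ ((extChartAt (𝓡 n) p).left_inv hp)
  ext k
  have h1 : ∀ i, partialD i (chartRead n p fun q => coordForm n p q k (X q)) y =
      fderiv ℝ Y y (EuclideanSpace.single i 1) k := by
    intro i
    have h := ((EuclideanSpace.proj k : EuclideanSpace ℝ (Fin n) →L[ℝ] ℝ).hasFDerivAt.comp y
      hX.hasFDerivAt).fderiv
    rw [partialD, show (chartRead n p fun q => coordForm n p q k (X q)) =
      (EuclideanSpace.proj k : EuclideanSpace ℝ (Fin n) →L[ℝ] ℝ) ∘ Y from rfl, h]
    rfl
  have h2 : ∀ l, toCoord n p p (coordField n p p l) = EuclideanSpace.single l 1 :=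
    fun l => toCoord_ofCoord hp _
  rw [nablaAt_apply, hYy]
  simp only [covDeriv, sum_apply, ContinuousLinearMap.smulRight_apply,
    smul_apply, map_sum, map_smul, h2, ← hyy, christoffel_eq hy]
  have e1 := clm_apply_eq_sum (fderiv ℝ Y y) (toCoord n p p v)
  have e2 := clm_apply_eq_sum (connectionForm (chartMetric n p) y) (toCoord n p p v)
  rw [e1, e2]
  simp only [sum_apply, smul_apply, PiLp.add_apply,
    WithLp.ofLp_sum, WithLp.ofLp_smul, Finset.sum_apply, Pi.smul_apply, PiLp.single_apply,
    smul_eq_mul, mul_ite, mul_one, mul_zero, Finset.sum_ite_eq, Finset.mem_univ, if_true]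
  rw [← Finset.sum_add_distrib]
  refine Finset.sum_congr rfl fun i _ => ?_
  have e3 := clm_apply_eq_sum (connectionForm (chartMetric n p) y (EuclideanSpace.single i 1))
    (toCoord n p p (X p))
  rw [e3]
  simp only [WithLp.ofLp_sum, WithLp.ofLp_smul, Finset.sum_apply, Pi.smul_apply, smul_eq_mul]
  rw [mul_comm, mul_add]
  exact congrArg₂ (· + ·) (congrArg₂ (· * ·) rfl (h1 i)) (congrArg₂ (· * ·) rfl
    (Finset.sum_congr rfl fun j _ => mul_comm _ _))

theorem ricci_apply (p : M) (v w : TangentSpace (𝓡 n) p) :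
    ricci n p v w = clmTrace (curvEndo (chartMetric n p) (extChartAt (𝓡 n) p p)
      (toCoord n p p v) (toCoord n p p w)) := by
  have hy := mem_extChartAt_target (I := 𝓡 n) p
  have hg := smoothMetricOn_chartMetric (n := n) p
  set y := extChartAt (𝓡 n) p p with hyy
  set Γ := connectionForm (chartMetric n p) with hΓ
  have dΓ := hg.differentiableAt hg.contDiffOn_connectionForm hy
  have h1 : ∀ l i j k, partialD k (christoffel n p l i j) y =
      fderiv ℝ Γ y (EuclideanSpace.single k 1) (EuclideanSpace.single i 1)
        (EuclideanSpace.single j 1) l := by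
    intro l i j k
    have he : christoffel n p l i j =ᶠ[nhds y]
        (EuclideanSpace.proj l : EuclideanSpace ℝ (Fin n) →L[ℝ] ℝ) ∘
          fun z => Γ z (EuclideanSpace.single i 1) (EuclideanSpace.single j 1) := by
      filter_upwards [hg.isOpen.mem_nhds hy] with z hz using christoffel_eq hz l i j
    have d1 := dΓ.clm_apply (differentiableAt_const (EuclideanSpace.single i (1 : ℝ)))
    have d2 := d1.clm_apply (differentiableAt_const (EuclideanSpace.single j (1 : ℝ)))
    rw [partialD, he.fderiv_eq, ((EuclideanSpace.proj l :
      EuclideanSpace ℝ (Fin n) →L[ℝ] ℝ).hasFDerivAt.comp y d2.hasFDerivAt).fderiv,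
      fderiv_clm_apply d1 (differentiableAt_const _), fderiv_clm_apply dΓ (differentiableAt_const _)]
    simp [hΓ]
  have h2 : ∀ l k i j, (∑ m, christoffel n p l k m y * christoffel n p m i j y) =
      Γ y (EuclideanSpace.single k 1)
        (Γ y (EuclideanSpace.single i 1) (EuclideanSpace.single j 1)) l := by
    intro l k i j
    rw [clm_apply_eq_sum (Γ y (EuclideanSpace.single k 1))
      (Γ y (EuclideanSpace.single i 1) (EuclideanSpace.single j 1))]
    simp only [WithLp.ofLp_sum, WithLp.ofLp_smul, Finset.sum_apply, Pi.smul_apply, smul_eq_mul]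
    exact Finset.sum_congr rfl fun m _ => by rw [christoffel_eq hy, christoffel_eq hy, mul_comm]
  have hcoeff : ∀ k i j, curvatureCoeff n p k j k i y =
      curvEndo (chartMetric n p) y (EuclideanSpace.single i 1) (EuclideanSpace.single j 1)
        (EuclideanSpace.single k 1) k := by
    intro k i j
    rw [curvatureCoeff, Finset.sum_sub_distrib, h2 k k i j, h2 k i k j, h1, h1, curvEndo_apply]
    simp only [PiLp.add_apply, PiLp.sub_apply]
    ring
  rw [ricci, formOfCoeff_apply, clmTrace_eq_sum]
  simp only [hcoeff, ← hyy]
  -- For fixed `k` this component is bilinear in the two vectors; `S` packages it as a bilinear map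
  -- so that it can be expanded in the basis.
  have key : ∀ k, curvEndo (chartMetric n p) y (toCoord n p p v) (toCoord n p p w)
      (EuclideanSpace.single k 1) k = ∑ i, ∑ j, curvEndo (chartMetric n p) y
        (EuclideanSpace.single i 1) (EuclideanSpace.single j 1) (EuclideanSpace.single k 1) k *
        (toCoord n p p v i * toCoord n p p w j) := by
    intro k
    set z : EuclideanSpace ℝ (Fin n) := EuclideanSpace.single k 1
    let S : EuclideanSpace ℝ (Fin n) →L[ℝ] EuclideanSpace ℝ (Fin n) →L[ℝ]
        EuclideanSpace ℝ (Fin n) := fderiv ℝ Γ y z - (fderiv ℝ Γ y).flip z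
      + (ContinuousLinearMap.compL ℝ _ _ _ (Γ y z)) ∘L Γ y
      - ((ContinuousLinearMap.compL ℝ _ _ _).flip (Γ y z)) ∘L Γ y
    have hS : ∀ v w, S v w = curvEndo (chartMetric n p) y v w z := by
      intro v w
      rw [curvEndo_apply]
      simp [S, hΓ]
    have h := clm_apply₂_eq_sum ((ContinuousLinearMap.compL ℝ _ _ _ (EuclideanSpace.proj k :
      EuclideanSpace ℝ (Fin n) →L[ℝ] ℝ)) ∘L S) (toCoord n p p v) (toCoord n p p w)
    simp only [ContinuousLinearMap.comp_apply, ContinuousLinearMap.compL_apply, hS,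
      PiLp.proj_apply] at h
    exact h
  simp only [key, Finset.sum_mul]
  symm
  rw [Finset.sum_comm]
  exact Finset.sum_congr rfl fun i _ => Finset.sum_comm

end Smooth

end ChartMetric

/-! ### Independence of the Hessian and the Laplacian from the chart. -/

section Invariance

set_option linter.unusedSectionVars false
set_option maxSynthPendingDepth 3

open scoped RealInnerProductSpace

variable (n : ℕ) {M : Type*} [TopologicalSpace M] [ChartedSpace (EuclideanSpace ℝ (Fin n)) M]
  [IsManifold (𝓡 n) ∞ M]
  [RiemannianBundle (fun x : M => TangentSpace (𝓡 n) x)]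

/-- The Hessian of `f` at `q` as an endomorphism, computed in the chart at `c`. -/
noncomputable def hessEndo (c : M) (f : M → ℝ) (q : M) :
    TangentSpace (𝓡 n) q →L[ℝ] TangentSpace (𝓡 n) q :=
  ofCoord n c q ∘L hessAt (chartMetric n c) (chartRead n c f) (extChartAt (𝓡 n) c q) ∘L
    toCoord n c q

variable {n} {c c' q : M} {W : Set M} {f a b : M → ℝ}

theorem inner_grad (f : M → ℝ) (q : M) (v : TangentSpace (𝓡 n) q) :
    ⟪grad n f q, v⟫ = mvfderiv (𝓡 n) f q v :=
  inner_formSharp _ _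

variable [IsContMDiffRiemannianBundle (𝓡 n) ∞ (EuclideanSpace ℝ (Fin n))
      (fun x : M => TangentSpace (𝓡 n) x)]

theorem toCoord_grad (hq : q ∈ (extChartAt (𝓡 n) c).source)
    (hf : DifferentiableAt ℝ (chartRead n c f) (extChartAt (𝓡 n) c q)) :
    toCoord n c q (grad n f q) =
      gradAt (chartMetric n c) (chartRead n c f) (extChartAt (𝓡 n) c q) := by
  have hg := smoothMetricOn_chartMetric (n := n) c
  have hy := (extChartAt (𝓡 n) c).map_source hq
  refine hg.ext_apply hy fun z => ?_
  rw [hg.apply_gradAt hy, ← toCoord_ofCoord hq z, chartMetric_toCoord hq, inner_grad,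
    mvfderiv_eq_fderiv_chartRead hq hf]

theorem chartRead_inner_grad (hW : IsOpen W) (hf : ContMDiffOn (𝓡 n) 𝓘(ℝ, ℝ) ∞ f W)
    (hb : ContMDiffOn (𝓡 n) 𝓘(ℝ, ℝ) ∞ b W) {y : EuclideanSpace ℝ (Fin n)}
    (hy : y ∈ chartImage n c W) :
    chartRead n c (fun q => ⟪grad n f q, grad n b q⟫) y =
      chartMetric n c y (gradAt (chartMetric n c) (chartRead n c f) y)
        (gradAt (chartMetric n c) (chartRead n c b) y) := by
  have hg := smoothMetricOn_chartImage (n := n) c hW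
  have hq := (extChartAt (𝓡 n) c).map_target hy.1
  have hr := (extChartAt (𝓡 n) c).right_inv hy.1
  have df := hg.differentiableAt (contDiffOn_chartRead hf) hy
  have db := hg.differentiableAt (contDiffOn_chartRead hb) hy
  have h1 := toCoord_grad (f := f) hq (by rwa [hr])
  have h2 := toCoord_grad (f := b) hq (by rwa [hr])
  rw [chartRead, ← chartMetric_toCoord hq, h1, h2, hr]

theorem fderiv_chartMetric_gradAt (hW : IsOpen W) (hq : q ∈ (extChartAt (𝓡 n) c).source)
    (hqW : q ∈ W) (hf : ContMDiffOn (𝓡 n) 𝓘(ℝ, ℝ) ∞ f W) (hb : ContMDiffOn (𝓡 n) 𝓘(ℝ, ℝ) ∞ b W)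
    (v : TangentSpace (𝓡 n) q) :
    fderiv ℝ (fun y => chartMetric n c y (gradAt (chartMetric n c) (chartRead n c f) y)
        (gradAt (chartMetric n c) (chartRead n c b) y)) (extChartAt (𝓡 n) c q)
        (toCoord n c q v) =
      mvfderiv (𝓡 n) (fun q => ⟪grad n f q, grad n b q⟫) q v := by
  have hg := smoothMetricOn_chartImage (n := n) c hW
  have hy : extChartAt (𝓡 n) c q ∈ chartImage n c W := mem_chartImage hq hqW
  have he : chartRead n c (fun q => ⟪grad n f q, grad n b q⟫) =ᶠ[nhds (extChartAt (𝓡 n) c q)]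
      fun y => chartMetric n c y (gradAt (chartMetric n c) (chartRead n c f) y)
        (gradAt (chartMetric n c) (chartRead n c b) y) := by
    filter_upwards [hg.isOpen.mem_nhds hy] with y hy using chartRead_inner_grad hW hf hb hy
  have hd := hg.differentiableAt (hg.contDiffOn_inner
    (hg.contDiffOn_gradAt (contDiffOn_chartRead hf))
    (hg.contDiffOn_gradAt (contDiffOn_chartRead hb))) hy
  rw [← he.fderiv_eq, mvfderiv_eq_fderiv_chartRead hq (hd.congr_of_eventuallyEq he)]

theorem inner_hessEndo (hq : q ∈ (extChartAt (𝓡 n) c).source) (v w : TangentSpace (𝓡 n) q) :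
    ⟪hessEndo n c f q v, w⟫ = chartMetric n c (extChartAt (𝓡 n) c q)
      (hessAt (chartMetric n c) (chartRead n c f) (extChartAt (𝓡 n) c q) (toCoord n c q v))
      (toCoord n c q w) := by
  rw [← chartMetric_toCoord hq]
  simp only [hessEndo, ContinuousLinearMap.comp_apply, toCoord_ofCoord hq]

/-- The right side uses only differentials, gradients and inner products on `M`: the chart `c` has
disappeared, which is the source of invariance. -/
theorem two_mul_inner_hessEndo_grad (hW : IsOpen W) (hq : q ∈ (extChartAt (𝓡 n) c).source)
    (hqW : q ∈ W) (hf : ContMDiffOn (𝓡 n) 𝓘(ℝ, ℝ) ∞ f W) (ha : ContMDiffOn (𝓡 n) 𝓘(ℝ, ℝ) ∞ a W)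
    (hb : ContMDiffOn (𝓡 n) 𝓘(ℝ, ℝ) ∞ b W) :
    2 * ⟪hessEndo n c f q (grad n a q), grad n b q⟫ =
      mvfderiv (𝓡 n) (fun q => ⟪grad n f q, grad n b q⟫) q (grad n a q)
      + mvfderiv (𝓡 n) (fun q => ⟪grad n f q, grad n a q⟫) q (grad n b q)
      - mvfderiv (𝓡 n) (fun q => ⟪grad n a q, grad n b q⟫) q (grad n f q) := by
  have hg := smoothMetricOn_chartImage (n := n) c hW
  have hy : extChartAt (𝓡 n) c q ∈ chartImage n c W := mem_chartImage hq hqW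
  have hF := contDiffOn_chartRead (c := c) hf
  have hA := contDiffOn_chartRead (c := c) ha
  have hB := contDiffOn_chartRead (c := c) hb
  rw [← fderiv_chartMetric_gradAt hW hq hqW hf hb, ← fderiv_chartMetric_gradAt hW hq hqW hf ha,
    ← fderiv_chartMetric_gradAt hW hq hqW ha hb, inner_hessEndo hq,
    toCoord_grad hq (hg.differentiableAt hF hy), toCoord_grad hq (hg.differentiableAt hA hy),
    toCoord_grad hq (hg.differentiableAt hB hy)]
  exact hg.two_mul_hessAt_gradAt hy hF hA hB

/-- Take the function that is linear in the chart, with differential at `q` equal to the pairing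
with `v`. Thus identities for gradients test all tangent vectors. -/
theorem exists_grad_eq (hq : q ∈ (extChartAt (𝓡 n) c).source) (v : TangentSpace (𝓡 n) q) :
    ∃ a : M → ℝ, ContMDiffOn (𝓡 n) 𝓘(ℝ, ℝ) ∞ a (extChartAt (𝓡 n) c).source ∧ grad n a q = v := by
  have hg := smoothMetricOn_chartMetric (n := n) c
  have hy := (extChartAt (𝓡 n) c).map_source hq
  set l := chartMetric n c (extChartAt (𝓡 n) c q) (toCoord n c q v) with hl
  have hread : ∀ y ∈ (extChartAt (𝓡 n) c).target,
      chartRead n c (fun q => l (extChartAt (𝓡 n) c q)) y = l y := fun y hy => by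
    rw [chartRead, (extChartAt (𝓡 n) c).right_inv hy]
  have he : chartRead n c (fun q => l (extChartAt (𝓡 n) c q)) =ᶠ[nhds (extChartAt (𝓡 n) c q)] l := by
    filter_upwards [hg.isOpen.mem_nhds hy] with y hy using hread y hy
  refine ⟨fun q => l (extChartAt (𝓡 n) c q), ?_, ?_⟩
  · rw [extChartAt_source]
    exact l.contDiff.contMDiff.comp_contMDiffOn contMDiffOn_extChartAt
  · rw [← ofCoord_toCoord hq v, ← ofCoord_toCoord hq (grad n _ q)]
    congr 1
    rw [toCoord_grad hq (l.differentiableAt.congr_of_eventuallyEq he)]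
    refine hg.ext_apply hy fun z => ?_
    rw [hg.apply_gradAt hy, he.fderiv_eq, l.fderiv]

/-- The Hessian does not depend on the chart. -/
theorem hessEndo_eq (hW : IsOpen W) (hq : q ∈ (extChartAt (𝓡 n) c).source)
    (hq' : q ∈ (extChartAt (𝓡 n) c').source) (hqW : q ∈ W)
    (hf : ContMDiffOn (𝓡 n) 𝓘(ℝ, ℝ) ∞ f W) : hessEndo n c f q = hessEndo n c' f q := by
  ext1 v
  refine ext_inner_right ℝ fun w => ?_
  obtain ⟨a, ha, rfl⟩ := exists_grad_eq hq v
  obtain ⟨b, hb, rfl⟩ := exists_grad_eq hq w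
  set W' := W ∩ (extChartAt (𝓡 n) c).source
  have hW' : IsOpen W' := hW.inter (isOpen_extChartAt_source c)
  have hqW' : q ∈ W' := ⟨hqW, hq⟩
  have hf' := hf.mono (Set.inter_subset_left : W' ⊆ W)
  have ha' := ha.mono (Set.inter_subset_right : W' ⊆ _)
  have hb' := hb.mono (Set.inter_subset_right : W' ⊆ _)
  have h1 := two_mul_inner_hessEndo_grad hW' hq hqW' hf' ha' hb'
  have h2 := two_mul_inner_hessEndo_grad hW' hq' hqW' hf' ha' hb'
  linarith

theorem hessian_eq_inner_hessEndo (hW : IsOpen W) (hqW : q ∈ W)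
    (hf : ContMDiffOn (𝓡 n) 𝓘(ℝ, ℝ) ∞ f W) (v w : TangentSpace (𝓡 n) q) :
    hessian n f q v w = ⟪hessEndo n q f q v, w⟫ := by
  rw [hessian_apply q hW hqW hf, inner_hessEndo (mem_extChartAt_source q)]

theorem trace_ofCoord_comp_toCoord (hq : q ∈ (extChartAt (𝓡 n) c).source)
    (A : EuclideanSpace ℝ (Fin n) →L[ℝ] EuclideanSpace ℝ (Fin n)) :
    LinearMap.trace ℝ (TangentSpace (𝓡 n) q)
      ((ofCoord n c q ∘L A ∘L toCoord n c q :
        TangentSpace (𝓡 n) q →L[ℝ] TangentSpace (𝓡 n) q) :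
        TangentSpace (𝓡 n) q →ₗ[ℝ] TangentSpace (𝓡 n) q) = clmTrace A := by
  have h := LinearMap.trace_comp_comm' ((A ∘L toCoord n c q : TangentSpace (𝓡 n) q →L[ℝ]
      EuclideanSpace ℝ (Fin n)) : TangentSpace (𝓡 n) q →ₗ[ℝ] EuclideanSpace ℝ (Fin n))
    (ofCoord n c q : EuclideanSpace ℝ (Fin n) →ₗ[ℝ] TangentSpace (𝓡 n) q)
  refine (Eq.trans ?_ h).trans ?_
  · rfl
  · rw [clmTrace]
    congr 1
    ext1 v
    exact congrArg A (toCoord_ofCoord hq v)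

/-- The Laplacian, computed in any chart. -/
theorem laplacian_eq_clmTrace (hW : IsOpen W) (hq : q ∈ (extChartAt (𝓡 n) c).source)
    (hqW : q ∈ W) (hf : ContMDiffOn (𝓡 n) 𝓘(ℝ, ℝ) ∞ f W) :
    laplacian n f q =
      clmTrace (hessAt (chartMetric n c) (chartRead n c f) (extChartAt (𝓡 n) c q)) := by
  -- The definition uses the chart at `q`; `hessEndo_eq` passes to the chart at `c`, where `q` may
  -- vary.
  rw [laplacian, formTrace_eq_trace _ (hessEndo n q f q : TangentSpace (𝓡 n) q →ₗ[ℝ] _)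
    (hessian_eq_inner_hessEndo hW hqW hf), hessEndo_eq hW (mem_extChartAt_source q) hq hqW hf]
  exact trace_ofCoord_comp_toCoord hq _

end Invariance

/-! ### Gradient and Laplacian of the norm of a gradient, in local form. -/

section GradientNorm

set_option linter.unusedSectionVars false
set_option maxSynthPendingDepth 3

variable {E : Type*} [NormedAddCommGroup E] [NormedSpace ℝ E]

theorem nablaAt_congr {g : E → E →L[ℝ] E →L[ℝ] ℝ} {X Y : E → E} {x : E} (h : X =ᶠ[nhds x] Y) :
    nablaAt g X x = nablaAt g Y x := by
  rw [nablaAt, nablaAt, h.fderiv_eq, h.eq_of_nhds]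

theorem hasFDerivAt_inv_comp {f : E → ℝ} {x : E} (hf : DifferentiableAt ℝ f x) (h0 : f x ≠ 0) :
    HasFDerivAt (fun y => (f y)⁻¹) (-((f x ^ 2)⁻¹ • fderiv ℝ f x)) x := by
  have h := (hasDerivAt_inv h0).comp_hasFDerivAt x hf.hasFDerivAt
  rwa [neg_smul] at h

variable [FiniteDimensional ℝ E]

namespace SmoothMetricOn

variable {Ω : Set E} {g : E → E →L[ℝ] E →L[ℝ] ℝ} (hg : SmoothMetricOn Ω g) {x : E} {f h : E → ℝ}

include hg

theorem gradAt_sq (hx : x ∈ Ω) (hf : ContDiffOn ℝ ∞ f Ω) :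
    gradAt g (fun y => f y ^ 2) x = (2 * f x) • gradAt g f x := by
  refine hg.ext_apply hx fun z => ?_
  rw [hg.apply_gradAt hx, fderiv_fun_pow 2 (hg.differentiableAt hf hx)]
  simp [hg.apply_gradAt hx]

theorem hessAt_sq (hx : x ∈ Ω) (hf : ContDiffOn ℝ ∞ f Ω) :
    hessAt g (fun y => f y ^ 2) x =
      (2 * f x) • hessAt g f x + ((2 : ℝ) • fderiv ℝ f x).smulRight (gradAt g f x) := by
  have he : gradAt g (fun y => f y ^ 2) =ᶠ[nhds x] fun y => (2 * f y) • gradAt g f y := by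
    filter_upwards [hg.isOpen.mem_nhds hx] with y hy using hg.gradAt_sq hy hf
  have df := hg.differentiableAt hf hx
  rw [hessAt, nablaAt_congr he, hg.nablaAt_smul (df.const_mul 2)
    (hg.differentiableAt (hg.contDiffOn_gradAt hf) hx), fderiv_const_mul df]
  rfl

theorem clmTrace_hessAt_sq (hx : x ∈ Ω) (hf : ContDiffOn ℝ ∞ f Ω) :
    clmTrace (hessAt g (fun y => f y ^ 2) x) =
      2 * f x * clmTrace (hessAt g f x) + 2 * g x (gradAt g f x) (gradAt g f x) := by
  rw [hg.hessAt_sq hx hf, clmTrace_add, clmTrace_smul, clmTrace_smulRight, hg.apply_gradAt hx]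
  simp

variable (hf : ContDiffOn ℝ ∞ f Ω) (hh : ContDiffOn ℝ ∞ h Ω) (hpos : ∀ y ∈ Ω, 0 < h y)
  (hsq : ∀ y ∈ Ω, h y ^ 2 = g y (gradAt g f y) (gradAt g f y))

include hf hh hpos hsq

/-- The gradient of `h = |∇f|`. -/
theorem gradAt_norm (hx : x ∈ Ω) :
    gradAt g h x = (h x)⁻¹ • hessAt g f x (gradAt g f x) := by
  have he : (fun y => h y ^ 2) =ᶠ[nhds x] fun y => g y (gradAt g f y) (gradAt g f y) := by
    filter_upwards [hg.isOpen.mem_nhds hx] with y hy using hsq y hy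
  -- Differentiating `h² = |∇f|²` gives `2h ∇h = 2 Hess f (∇f)`.
  have h1 := hg.gradAt_normSq hx hf
  rw [gradAt, ← he.fderiv_eq, ← gradAt, hg.gradAt_sq hx hh, mul_smul] at h1
  have h2 := smul_right_injective E (two_ne_zero (α := ℝ)) h1
  rw [← h2, inv_smul_smul₀ (hpos x hx).ne']

/-- The covariant derivative of a vector field divided by `h = |∇f|`. -/
theorem nablaAt_inv_smul {X : E → E} (hx : x ∈ Ω) (hX : DifferentiableAt ℝ X x) :
    nablaAt g (fun y => (h y)⁻¹ • X y) x =
      (h x)⁻¹ • nablaAt g X x - ((h x ^ 2)⁻¹ • fderiv ℝ h x).smulRight (X x) := by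
  have dh := hg.differentiableAt hh hx
  have h0 := (hpos x hx).ne'
  have hd := hasFDerivAt_inv_comp dh h0
  rw [hg.nablaAt_smul hd.differentiableAt hX, hd.fderiv]
  ext v
  simp
  abel

/-- The Laplacian of `h = |∇f|`. -/
theorem clmTrace_hessAt_norm (hx : x ∈ Ω) :
    clmTrace (hessAt g h x) = (h x)⁻¹ * (clmTrace (hessAt g f x ∘L hessAt g f x)
        + clmTrace (curvEndo g x (gradAt g f x) (gradAt g f x))
        + fderiv ℝ (fun y => clmTrace (hessAt g f y)) x (gradAt g f x))
      - (h x ^ 3)⁻¹ * g x (hessAt g f x (gradAt g f x)) (hessAt g f x (gradAt g f x)) := by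
  -- The formula for `∇h` holds near `x`, so its divergence may be taken: Bochner's formula covers
  -- the main factor and the derivative of `h⁻¹` gives the last term.
  have he : gradAt g h =ᶠ[nhds x] fun y => (h y)⁻¹ • hessAt g f y (gradAt g f y) := by
    filter_upwards [hg.isOpen.mem_nhds hx] with y hy using hg.gradAt_norm hf hh hpos hsq hy
  have dX := hg.differentiableAt ((hg.contDiffOn_hessAt hf).clm_apply (hg.contDiffOn_gradAt hf)) hx
  have hd : fderiv ℝ h x (hessAt g f x (gradAt g f x)) =
      (h x)⁻¹ * g x (hessAt g f x (gradAt g f x)) (hessAt g f x (gradAt g f x)) := by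
    rw [← hg.apply_gradAt hx, hg.gradAt_norm hf hh hpos hsq hx]
    simp
  rw [hessAt, nablaAt_congr he, hg.nablaAt_inv_smul hf hh hpos hsq hx dX, clmTrace_sub,
    clmTrace_smul, clmTrace_smulRight, hg.trace_nablaAt_hessAt_gradAt hx hf,
    smul_apply, hd, smul_eq_mul, ← mul_assoc, ← mul_inv, ← pow_succ]

/-- The Laplacian of `h = |∇f|` if `f Δf = m |∇f|²`. -/
theorem clmTrace_hessAt_norm_of_eq (hx : x ∈ Ω) (m : ℝ) (hfpos : ∀ y ∈ Ω, f y ≠ 0)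
    (heq : ∀ y ∈ Ω, clmTrace (hessAt g f y) = m * (h y ^ 2 / f y)) :
    clmTrace (hessAt g h x) = (h x)⁻¹ * (clmTrace (hessAt g f x ∘L hessAt g f x)
        + clmTrace (curvEndo g x (gradAt g f x) (gradAt g f x))
        + m * (2 * g x (hessAt g f x (gradAt g f x)) (gradAt g f x) / f x - h x ^ 4 / f x ^ 2))
      - (h x ^ 3)⁻¹ * g x (hessAt g f x (gradAt g f x)) (hessAt g f x (gradAt g f x)) := by
  have he : (fun y => clmTrace (hessAt g f y)) =ᶠ[nhds x] fun y => m * (h y ^ 2 * (f y)⁻¹) := by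
    filter_upwards [hg.isOpen.mem_nhds hx] with y hy
    rw [heq y hy, div_eq_mul_inv]
  have dh := hg.differentiableAt hh hx
  have df := hg.differentiableAt hf hx
  have h0 := (hpos x hx).ne'
  have hf0 := hfpos x hx
  have hdh : fderiv ℝ h x (gradAt g f x) =
      (h x)⁻¹ * g x (hessAt g f x (gradAt g f x)) (gradAt g f x) := by
    rw [← hg.apply_gradAt hx, hg.gradAt_norm hf hh hpos hsq hx]
    simp
  have hdf : fderiv ℝ f x (gradAt g f x) = h x ^ 2 := by
    rw [← hg.apply_gradAt hx, hsq x hx]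
  have hder := (((dh.hasFDerivAt.pow 2).mul (hasFDerivAt_inv_comp df hf0)).const_mul m).fderiv
  -- The quotient rule for `h² / f` along `∇f`, with `h dh(∇f) = ⟪Hess f (∇f), ∇f⟫` and `df(∇f) =
  -- h²`.
  have hD : fderiv ℝ (fun y => clmTrace (hessAt g f y)) x (gradAt g f x) =
      m * (2 * g x (hessAt g f x (gradAt g f x)) (gradAt g f x) / f x - h x ^ 4 / f x ^ 2) := by
    rw [he.fderiv_eq]
    refine (congrArg (fun L : E →L[ℝ] ℝ => L (gradAt g f x)) hder).trans ?_
    simp [hdh, hdf]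
    field_simp
    ring
  rw [hg.clmTrace_hessAt_norm hf hh hpos hsq hx, hD]

end SmoothMetricOn

end GradientNorm

/-! ### Transfer to the manifold, and the second fundamental form of level sets. -/

section LevelSets

set_option linter.unusedSectionVars false
set_option maxSynthPendingDepth 3

open scoped RealInnerProductSpace

variable {n : ℕ} {M : Type*} [TopologicalSpace M] [ChartedSpace (EuclideanSpace ℝ (Fin n)) M]
  [IsManifold (𝓡 n) ∞ M]
  [RiemannianBundle (fun x : M => TangentSpace (𝓡 n) x)]
  [IsContMDiffRiemannianBundle (𝓡 n) ∞ (EuclideanSpace ℝ (Fin n))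
      (fun x : M => TangentSpace (𝓡 n) x)]
  {U : Set M} {u : M → ℝ} {p : M}

theorem contMDiffAt_norm_grad (hU : IsOpen U) (hu : ContMDiffOn (𝓡 n) 𝓘(ℝ, ℝ) ∞ u U) (hp : p ∈ U)
    (hgrad : grad n u p ≠ 0) : ContMDiffAt (𝓡 n) 𝓘(ℝ, ℝ) ∞ (fun q => ‖grad n u q‖) p := by
  have hg := smoothMetricOn_chartImage (n := n) p hU
  have hy : extChartAt (𝓡 n) p p ∈ chartImage n p U :=
    mem_chartImage (mem_extChartAt_source p) hp
  have hF := contDiffOn_chartRead (c := p) hu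
  have h1 : ContDiffAt ℝ ∞ (chartRead n p fun q => ⟪grad n u q, grad n u q⟫)
      (extChartAt (𝓡 n) p p) := by
    refine (hg.contDiffAt (hg.contDiffOn_inner (hg.contDiffOn_gradAt hF)
      (hg.contDiffOn_gradAt hF)) hy).congr_of_eventuallyEq ?_
    filter_upwards [hg.isOpen.mem_nhds hy] with y hy using chartRead_inner_grad hU hu hu hy
  have h2 := contMDiffAt_of_chartRead (mem_extChartAt_source p) h1
  have h3 : (fun q => ‖grad n u q‖) = Real.sqrt ∘ fun q => ⟪grad n u q, grad n u q⟫ := by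
    ext q; exact norm_eq_sqrt_real_inner _
  rw [h3]
  exact (Real.contDiffAt_sqrt (inner_self_ne_zero.2 hgrad)).contMDiffAt.comp p h2

/-- The local formulas require `h = |∇u|` to be smooth and positive on a whole open set; this set
provides it. -/
theorem isOpen_setOf_grad_ne_zero (hU : IsOpen U) (hu : ContMDiffOn (𝓡 n) 𝓘(ℝ, ℝ) ∞ u U) :
    IsOpen {q | q ∈ U ∧ grad n u q ≠ 0} := by
  rw [isOpen_iff_mem_nhds]
  rintro q ⟨hq, hq0⟩
  have h := (contMDiffAt_norm_grad hU hu hq hq0).continuousAt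
  filter_upwards [hU.mem_nhds hq, h.eventually_ne (norm_ne_zero_iff.2 hq0)] with y hy hy0
  exact ⟨hy, norm_ne_zero_iff.1 hy0⟩

theorem chartRead_norm_grad_sq (hU : IsOpen U) (hu : ContMDiffOn (𝓡 n) 𝓘(ℝ, ℝ) ∞ u U) (c : M)
    {y : EuclideanSpace ℝ (Fin n)} (hy : y ∈ chartImage n c U) :
    chartRead n c (fun q => ‖grad n u q‖) y ^ 2 =
      chartMetric n c y (gradAt (chartMetric n c) (chartRead n c u) y)
        (gradAt (chartMetric n c) (chartRead n c u) y) := by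
  rw [← chartRead_inner_grad hU hu hu hy, chartRead, chartRead, real_inner_self_eq_norm_sq]

theorem toCoord_injective {v w : TangentSpace (𝓡 n) p} (h : toCoord n p p v = toCoord n p p w) :
    v = w := by
  rw [← ofCoord_toCoord (mem_extChartAt_source p) v, h, ofCoord_toCoord (mem_extChartAt_source p)]

theorem toCoord_hessEndo (f : M → ℝ) (v : TangentSpace (𝓡 n) p) :
    toCoord n p p (hessEndo n p f p v) = hessAt (chartMetric n p) (chartRead n p f)
      (extChartAt (𝓡 n) p p) (toCoord n p p v) :=
  toCoord_ofCoord (mem_extChartAt_source p) _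

theorem toCoord_grad_self (hU : IsOpen U) (hu : ContMDiffOn (𝓡 n) 𝓘(ℝ, ℝ) ∞ u U) (hp : p ∈ U) :
    toCoord n p p (grad n u p) =
      gradAt (chartMetric n p) (chartRead n p u) (extChartAt (𝓡 n) p p) :=
  toCoord_grad (mem_extChartAt_source p) ((smoothMetricOn_chartImage (n := n) p hU).differentiableAt
    (contDiffOn_chartRead hu) (mem_chartImage (mem_extChartAt_source p) hp))

theorem hessEndo_isSymmetric (hU : IsOpen U) (hu : ContMDiffOn (𝓡 n) 𝓘(ℝ, ℝ) ∞ u U) (hp : p ∈ U)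
    (v w : TangentSpace (𝓡 n) p) :
    ⟪hessEndo n p u p v, w⟫ = ⟪v, hessEndo n p u p w⟫ := by
  have hps := mem_extChartAt_source (I := 𝓡 n) p
  rw [inner_hessEndo hps, ← chartMetric_toCoord hps v, toCoord_hessEndo]
  exact (smoothMetricOn_chartImage (n := n) p hU).hessAt_symm (mem_chartImage hps hp)
    (contDiffOn_chartRead hu) _ _

theorem grad_sq (hU : IsOpen U) (hu : ContMDiffOn (𝓡 n) 𝓘(ℝ, ℝ) ∞ u U) (hp : p ∈ U) :
    grad n (fun q => u q ^ 2) p = (2 * u p) • grad n u p := by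
  have hps := mem_extChartAt_source (I := 𝓡 n) p
  refine toCoord_injective ?_
  rw [toCoord_grad_self hU (hu.pow 2) hp, map_smul, toCoord_grad_self hU hu hp]
  have h := (smoothMetricOn_chartImage (n := n) p hU).gradAt_sq (mem_chartImage hps hp)
    (contDiffOn_chartRead hu)
  rw [chartRead_extChartAt hps] at h
  exact h

theorem hessian_sq (hU : IsOpen U) (hu : ContMDiffOn (𝓡 n) 𝓘(ℝ, ℝ) ∞ u U) (hp : p ∈ U)
    (v w : TangentSpace (𝓡 n) p) :
    hessian n (fun q => u q ^ 2) p v w =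
      2 * u p * ⟪hessEndo n p u p v, w⟫ + 2 * ⟪grad n u p, v⟫ * ⟪grad n u p, w⟫ := by
  have hps := mem_extChartAt_source (I := 𝓡 n) p
  have hg := smoothMetricOn_chartImage (n := n) p hU
  have hy : extChartAt (𝓡 n) p p ∈ chartImage n p U := mem_chartImage hps hp
  have h := hg.hessAt_sq hy (contDiffOn_chartRead hu)
  rw [chartRead_extChartAt hps] at h
  rw [hessian_apply p hU hp (hu.pow 2), inner_hessEndo hps, ← chartMetric_toCoord hps _ v,
    ← chartMetric_toCoord hps _ w, toCoord_grad_self hU hu hp]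
  refine (congrArg (fun L : EuclideanSpace ℝ (Fin n) →L[ℝ] EuclideanSpace ℝ (Fin n) =>
    chartMetric n p (extChartAt (𝓡 n) p p) (L (toCoord n p p v)) (toCoord n p p w)) h).trans ?_
  simp only [add_apply, smul_apply, ContinuousLinearMap.smulRight_apply, map_add, map_smul,
    smul_eq_mul, hg.apply_gradAt hy]

theorem grad_norm_grad (hU : IsOpen U) (hu : ContMDiffOn (𝓡 n) 𝓘(ℝ, ℝ) ∞ u U) (hp : p ∈ U)
    (hgrad : grad n u p ≠ 0) :
    grad n (fun q => ‖grad n u q‖) p = ‖grad n u p‖⁻¹ • hessEndo n p u p (grad n u p) := by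
  have hps := mem_extChartAt_source (I := 𝓡 n) p
  have hW := isOpen_setOf_grad_ne_zero hU hu
  set W := {q | q ∈ U ∧ grad n u q ≠ 0}
  have huW := hu.mono (fun q hq => hq.1 : W ⊆ U)
  have hwW : ContMDiffOn (𝓡 n) 𝓘(ℝ, ℝ) ∞ (fun q => ‖grad n u q‖) W := fun q hq =>
    (contMDiffAt_norm_grad hU hu hq.1 hq.2).contMDiffWithinAt
  have h := (smoothMetricOn_chartImage (n := n) p hW).gradAt_norm (contDiffOn_chartRead huW)
    (contDiffOn_chartRead hwW) (fun y hy => norm_pos_iff.2 hy.2.2)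
    (fun y hy => chartRead_norm_grad_sq hW huW p hy) (mem_chartImage hps ⟨hp, hgrad⟩)
  refine toCoord_injective ?_
  rw [toCoord_grad_self hW hwW ⟨hp, hgrad⟩, map_smul, toCoord_hessEndo, toCoord_grad_self hU hu hp, h,
    chartRead_extChartAt hps]

/-- Differentiating `∇u / |∇u|` produces the Hessian over `|∇u|` and a multiple of `∇u`; the latter
vanishes against tangent vectors. -/
theorem secondFundamentalForm_apply (hU : IsOpen U) (hu : ContMDiffOn (𝓡 n) 𝓘(ℝ, ℝ) ∞ u U)
    (hp : p ∈ U) (hgrad : grad n u p ≠ 0) (v w : levelTangent n u p) :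
    secondFundamentalForm n u p v w =
      ‖grad n u p‖⁻¹ * ⟪hessEndo n p u p v, (w : TangentSpace (𝓡 n) p)⟫ := by
  have hps := mem_extChartAt_source (I := 𝓡 n) p
  have hW := isOpen_setOf_grad_ne_zero hU hu
  set W := {q | q ∈ U ∧ grad n u q ≠ 0}
  have huW := hu.mono (fun q hq => hq.1 : W ⊆ U)
  have hwW : ContMDiffOn (𝓡 n) 𝓘(ℝ, ℝ) ∞ (fun q => ‖grad n u q‖) W := fun q hq =>
    (contMDiffAt_norm_grad hU hu hq.1 hq.2).contMDiffWithinAt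
  have hg := smoothMetricOn_chartImage (n := n) p hW
  have hy : extChartAt (𝓡 n) p p ∈ chartImage n p W := mem_chartImage hps ⟨hp, hgrad⟩
  have hF := contDiffOn_chartRead (c := p) huW
  have hh := contDiffOn_chartRead (c := p) hwW
  have hpos : ∀ y ∈ chartImage n p W, 0 < chartRead n p (fun q => ‖grad n u q‖) y :=
    fun y hy => norm_pos_iff.2 hy.2.2
  have dV := hg.differentiableAt (hg.contDiffOn_gradAt hF) hy
  have he : (fun y => toCoord n p ((extChartAt (𝓡 n) p).symm y)
      (unitNormal n u ((extChartAt (𝓡 n) p).symm y))) =ᶠ[nhds (extChartAt (𝓡 n) p p)]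
      fun y => (chartRead n p (fun q => ‖grad n u q‖) y)⁻¹ •
        gradAt (chartMetric n p) (chartRead n p u) y := by
    filter_upwards [hg.isOpen.mem_nhds hy] with y hy
    have hr := (extChartAt (𝓡 n) p).right_inv hy.1
    have h := toCoord_grad (f := u) ((extChartAt (𝓡 n) p).map_target hy.1)
      (by rw [hr]; exact hg.differentiableAt hF hy)
    rw [unitNormal, map_smul, h, hr]
    rfl
  have dh := (hg.differentiableAt hh hy).inv (hpos _ hy).ne'
  have dX := (dh.smul dV).congr_of_eventuallyEq he
  have hcov := toCoord_covDeriv (unitNormal n u) p dX (v : TangentSpace (𝓡 n) p)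
  have hnab := hg.nablaAt_inv_smul hF hh hpos (fun y hy => chartRead_norm_grad_sq hW huW p hy)
    hy dV
  have hdw : ⟪grad n u p, (w : TangentSpace (𝓡 n) p)⟫ = 0 := (inner_grad u p _).trans w.2
  rw [← chartMetric_toCoord hps, toCoord_grad_self hU hu hp] at hdw
  change ⟪covDeriv n (unitNormal n u) p v, (w : TangentSpace (𝓡 n) p)⟫ = _
  rw [← chartMetric_toCoord hps, hcov, nablaAt_congr he, hnab, inner_hessEndo hps,
    chartRead_extChartAt hps]
  simp only [sub_apply, smul_apply, ContinuousLinearMap.smulRight_apply, map_sub, map_smul, hdw,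
    smul_eq_mul, mul_zero, sub_zero]
  rfl

theorem ricci_grad (hU : IsOpen U) (hu : ContMDiffOn (𝓡 n) 𝓘(ℝ, ℝ) ∞ u U) (hp : p ∈ U) :
    ricci n p (grad n u p) (grad n u p) =
      clmTrace (curvEndo (chartMetric n p) (extChartAt (𝓡 n) p p)
        (gradAt (chartMetric n p) (chartRead n p u) (extChartAt (𝓡 n) p p))
        (gradAt (chartMetric n p) (chartRead n p u) (extChartAt (𝓡 n) p p))) := by
  rw [ricci_apply, toCoord_grad_self hU hu hp]

theorem trace_hessEndo (f : M → ℝ) :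
    LinearMap.trace ℝ (TangentSpace (𝓡 n) p)
      (hessEndo n p f p : TangentSpace (𝓡 n) p →ₗ[ℝ] TangentSpace (𝓡 n) p) =
      clmTrace (hessAt (chartMetric n p) (chartRead n p f) (extChartAt (𝓡 n) p p)) :=
  trace_ofCoord_comp_toCoord (mem_extChartAt_source p) _

theorem trace_hessEndo_comp_self (f : M → ℝ) :
    LinearMap.trace ℝ (TangentSpace (𝓡 n) p)
      ((hessEndo n p f p : TangentSpace (𝓡 n) p →ₗ[ℝ] TangentSpace (𝓡 n) p) ∘ₗ
        (hessEndo n p f p : TangentSpace (𝓡 n) p →ₗ[ℝ] TangentSpace (𝓡 n) p)) =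
      clmTrace (hessAt (chartMetric n p) (chartRead n p f) (extChartAt (𝓡 n) p p) ∘L
        hessAt (chartMetric n p) (chartRead n p f) (extChartAt (𝓡 n) p p)) := by
  rw [← trace_ofCoord_comp_toCoord (mem_extChartAt_source p)]
  congr 1
  ext1 v
  exact congrArg (fun x => ofCoord n p p (hessAt (chartMetric n p) (chartRead n p f)
    (extChartAt (𝓡 n) p p) x)) (toCoord_hessEndo f v)

/-- The equation `Δ u² = 2 n |∇u|²` in the form `Δ u = (n - 1) |∇u|² / u`, in a chart. -/
theorem clmTrace_hessAt_of_laplacian_sq (hU : IsOpen U) (hu : ContMDiffOn (𝓡 n) 𝓘(ℝ, ℝ) ∞ u U)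
    (hpos : ∀ q ∈ U, 0 < u q)
    (heq : ∀ q ∈ U, laplacian n (fun x => u x ^ 2) q = 2 * (n : ℝ) * ‖grad n u q‖ ^ 2)
    (c : M) {y : EuclideanSpace ℝ (Fin n)} (hy : y ∈ chartImage n c U) :
    clmTrace (hessAt (chartMetric n c) (chartRead n c u) y) =
      ((n : ℝ) - 1) * (chartRead n c (fun q => ‖grad n u q‖) y ^ 2 / chartRead n c u y) := by
  -- The hypothesis is used at every point of the chart image, not only at the centre, because `Δu`
  -- will be differentiated.
  have h1 := heq _ hy.2
  rw [laplacian_eq_clmTrace hU ((extChartAt (𝓡 n) c).map_target hy.1) hy.2 (hu.pow 2),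
    (extChartAt (𝓡 n) c).right_inv hy.1] at h1
  have h2 := (smoothMetricOn_chartImage (n := n) c hU).clmTrace_hessAt_sq hy
    (contDiffOn_chartRead hu)
  rw [← chartRead_norm_grad_sq hU hu c hy] at h2
  have h3 : 2 * chartRead n c u y * clmTrace (hessAt (chartMetric n c) (chartRead n c u) y) +
      2 * chartRead n c (fun q => ‖grad n u q‖) y ^ 2 =
      2 * (n : ℝ) * chartRead n c (fun q => ‖grad n u q‖) y ^ 2 := h2.symm.trans h1
  have h0 : 0 < chartRead n c u y := hpos _ hy.2
  field_simp
  linarith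

theorem laplacian_norm_grad (hU : IsOpen U) (hu : ContMDiffOn (𝓡 n) 𝓘(ℝ, ℝ) ∞ u U)
    (hpos : ∀ q ∈ U, 0 < u q)
    (heq : ∀ q ∈ U, laplacian n (fun x => u x ^ 2) q = 2 * (n : ℝ) * ‖grad n u q‖ ^ 2)
    (hp : p ∈ U) (hgrad : grad n u p ≠ 0) :
    laplacian n (fun q => ‖grad n u q‖) p =
      ‖grad n u p‖⁻¹ * (LinearMap.trace ℝ (TangentSpace (𝓡 n) p)
          ((hessEndo n p u p : TangentSpace (𝓡 n) p →ₗ[ℝ] TangentSpace (𝓡 n) p) ∘ₗ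
            (hessEndo n p u p : TangentSpace (𝓡 n) p →ₗ[ℝ] TangentSpace (𝓡 n) p))
        + ricci n p (grad n u p) (grad n u p)
        + ((n : ℝ) - 1) * (2 * ⟪hessEndo n p u p (grad n u p), grad n u p⟫ / u p
            - ‖grad n u p‖ ^ 4 / u p ^ 2))
      - (‖grad n u p‖ ^ 3)⁻¹ * ‖hessEndo n p u p (grad n u p)‖ ^ 2 := by
  have hps := mem_extChartAt_source (I := 𝓡 n) p
  have hW := isOpen_setOf_grad_ne_zero hU hu
  set W := {q | q ∈ U ∧ grad n u q ≠ 0}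
  have hWU : W ⊆ U := fun q hq => hq.1
  have huW := hu.mono hWU
  have hwW : ContMDiffOn (𝓡 n) 𝓘(ℝ, ℝ) ∞ (fun q => ‖grad n u q‖) W := fun q hq =>
    (contMDiffAt_norm_grad hU hu hq.1 hq.2).contMDiffWithinAt
  have h := (smoothMetricOn_chartImage (n := n) p hW).clmTrace_hessAt_norm_of_eq
    (contDiffOn_chartRead huW) (contDiffOn_chartRead hwW) (fun y hy => norm_pos_iff.2 hy.2.2)
    (fun y hy => chartRead_norm_grad_sq hW huW p hy) (mem_chartImage hps ⟨hp, hgrad⟩)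
    ((n : ℝ) - 1) (fun y hy => (hpos _ hy.2.1).ne')
    (fun y hy => clmTrace_hessAt_of_laplacian_sq hU hu hpos heq p ⟨hy.1, hWU hy.2⟩)
  rw [laplacian_eq_clmTrace hW hps ⟨hp, hgrad⟩ hwW, h, chartRead_extChartAt hps,
    chartRead_extChartAt hps, trace_hessEndo_comp_self, ricci_grad hU hu hp, inner_hessEndo hps,
    ← real_inner_self_eq_norm_sq (hessEndo n p u p (grad n u p)), inner_hessEndo hps,
    toCoord_hessEndo, toCoord_grad_self hU hu hp]

end LevelSets

/-! ### Splitting the Hessian along the unit normal, and the final identity. -/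

section UnitNormal

set_option linter.unusedSectionVars false
set_option maxSynthPendingDepth 3

open scoped RealInnerProductSpace

variable {n : ℕ} {M : Type*} [TopologicalSpace M] [ChartedSpace (EuclideanSpace ℝ (Fin n)) M]
  [IsManifold (𝓡 n) ∞ M]
  [RiemannianBundle (fun x : M => TangentSpace (𝓡 n) x)]
  {U : Set M} {u : M → ℝ} {p : M}

theorem norm_unitNormal (hgrad : grad n u p ≠ 0) : ‖unitNormal n u p‖ = 1 :=
  norm_smul_inv_norm (𝕜 := ℝ) hgrad

theorem grad_eq_smul_unitNormal (hgrad : grad n u p ≠ 0) :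
    grad n u p = ‖grad n u p‖ • unitNormal n u p := by
  rw [unitNormal, smul_inv_smul₀ (norm_ne_zero_iff.2 hgrad)]

theorem mem_levelTangent_iff (hgrad : grad n u p ≠ 0) (v : TangentSpace (𝓡 n) p) :
    v ∈ levelTangent n u p ↔ ⟪unitNormal n u p, v⟫ = 0 := by
  rw [unitNormal, inner_smul_left, inner_grad]
  simp [levelTangent, hgrad]

/-- This is the trace splitting applied to the identity. -/
theorem finrank_levelTangent (hgrad : grad n u p ≠ 0) :
    (Module.finrank ℝ (levelTangent n u p) : ℝ) = (n : ℝ) - 1 := by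
  have h := trace_eq_trace_compression_add (norm_unitNormal hgrad) (mem_levelTangent_iff hgrad)
    LinearMap.id
  have hc : compression (levelTangent n u p) LinearMap.id = LinearMap.id := by
    ext v
    simp [compression]
  have hd : Module.finrank ℝ (TangentSpace (𝓡 n) p) = n :=
    finrank_euclideanSpace_fin (𝕜 := ℝ) (n := n)
  rw [hc, trace_id_eq_finrank, trace_id_eq_finrank, hd, LinearMap.id_apply,
    real_inner_self_eq_norm_sq, norm_unitNormal hgrad] at h
  linarith

variable [IsContMDiffRiemannianBundle (𝓡 n) ∞ (EuclideanSpace ℝ (Fin n))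
      (fun x : M => TangentSpace (𝓡 n) x)]

/-- In `Hess (u²) = 2u Hess u + 2 du ⊗ du` the second term, evaluated on the normal, is `2|∇u|²`
times the normal covector, which the metric term of `B` cancels. -/
theorem vectorB_eq (hU : IsOpen U) (hu : ContMDiffOn (𝓡 n) 𝓘(ℝ, ℝ) ∞ u U) (hp : p ∈ U)
    (hgrad : grad n u p ≠ 0) :
    vectorB n u p = (2 * u p) • hessEndo n p u p (unitNormal n u p) := by
  refine ext_inner_right ℝ fun w => ?_
  have h1 : ⟪grad n u p, unitNormal n u p⟫ = ‖grad n u p‖ := by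
    conv_lhs => rw [grad_eq_smul_unitNormal hgrad]
    rw [inner_smul_left, real_inner_self_eq_norm_sq, norm_unitNormal hgrad]
    simp
  have h2 : ⟪grad n u p, w⟫ = ‖grad n u p‖ * ⟪unitNormal n u p, w⟫ := by
    conv_lhs => rw [grad_eq_smul_unitNormal hgrad]
    rw [inner_smul_left]
    rfl
  have h3 : tensorB n u p (unitNormal n u p) w =
      hessian n (fun q => u q ^ 2) p (unitNormal n u p) w
        - 2 * ‖grad n u p‖ ^ 2 * ⟪unitNormal n u p, w⟫ := rfl
  rw [vectorB, inner_formSharp, h3, hessian_sq hU hu hp, h1, h2, inner_smul_left]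
  simp only [conj_trivial]
  ring

/-- The second fundamental form is the compressed Hessian over `|∇u|`, and the trace-free norm is
homogeneous of degree two. -/
theorem formNormSq_formTraceFree_secondFundamentalForm (hU : IsOpen U)
    (hu : ContMDiffOn (𝓡 n) 𝓘(ℝ, ℝ) ∞ u U) (hp : p ∈ U) (hgrad : grad n u p ≠ 0) :
    formNormSq (formTraceFree (secondFundamentalForm n u p)) =
      (‖grad n u p‖ ^ 2)⁻¹ * (LinearMap.trace ℝ (levelTangent n u p)
          (compression (levelTangent n u p)
            (hessEndo n p u p : TangentSpace (𝓡 n) p →ₗ[ℝ] TangentSpace (𝓡 n) p) ∘ₗ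
          compression (levelTangent n u p)
            (hessEndo n p u p : TangentSpace (𝓡 n) p →ₗ[ℝ] TangentSpace (𝓡 n) p))
        - (LinearMap.trace ℝ (levelTangent n u p) (compression (levelTangent n u p)
            (hessEndo n p u p : TangentSpace (𝓡 n) p →ₗ[ℝ] TangentSpace (𝓡 n) p))) ^ 2
          / ((n : ℝ) - 1)) := by
  set C := compression (levelTangent n u p)
    (hessEndo n p u p : TangentSpace (𝓡 n) p →ₗ[ℝ] TangentSpace (𝓡 n) p) with hC
  have h : ∀ v w, secondFundamentalForm n u p v w = ⟪(‖grad n u p‖⁻¹ • C) v, w⟫ := fun v w => by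
    rw [secondFundamentalForm_apply hU hu hp hgrad, LinearMap.smul_apply, inner_smul_left, hC,
      inner_compression]
    rfl
  have hsymm : (‖grad n u p‖⁻¹ • C).IsSymmetric := fun v w => by
    rw [LinearMap.smul_apply, LinearMap.smul_apply, inner_smul_left, inner_smul_right,
      real_inner_comm (C w), hC, inner_compression, inner_compression]
    have := hessEndo_isSymmetric hU hu hp (v : TangentSpace (𝓡 n) p) w
    rw [real_inner_comm (hessEndo n p u p w)] at this
    exact congrArg (fun t => ‖grad n u p‖⁻¹ * t) this
  rw [formNormSq_formTraceFree _ _ h hsymm, finrank_levelTangent hgrad, LinearMap.smul_comp,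
    LinearMap.comp_smul, map_smul, map_smul, map_smul, smul_eq_mul, smul_eq_mul, smul_eq_mul]
  field_simp

set_option maxHeartbeats 1000000 in
/-- The Laplacian of `|∇u|` for solutions of `Δ u² = 2 n |∇u|²`. -/
theorem laplacian_norm_grad_eq (hn : 2 ≤ n) (hU : IsOpen U)
    (hu : ContMDiffOn (𝓡 n) 𝓘(ℝ, ℝ) ∞ u U) (hpos : ∀ q ∈ U, 0 < u q)
    (heq : ∀ q ∈ U, laplacian n (fun x => u x ^ 2) q = 2 * (n : ℝ) * ‖grad n u q‖ ^ 2)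
    (hp : p ∈ U) (hgrad : grad n u p ≠ 0) :
    laplacian n (fun q => ‖grad n u q‖) p =
      ‖grad n u p‖ * formNormSq (formTraceFree (secondFundamentalForm n u p))
        + ricci n p (grad n u p) (grad n u p) / ‖grad n u p‖
        + ((n : ℝ) - 2) / u p ^ 2 *
            inner ℝ (grad n (fun q => ‖grad n u q‖) p) (grad n (fun q => u q ^ 2) p)
        + (‖vectorB n u p‖ ^ 2 + ((n : ℝ) - 2) * ‖vectorBTangent n u p‖ ^ 2)
            / (4 * ((n : ℝ) - 1) * ‖grad n u p‖ * u p ^ 2) := by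
  have hps := mem_extChartAt_source (I := 𝓡 n) p
  have hν := norm_unitNormal hgrad
  have hK := mem_levelTangent_iff hgrad
  set ν := unitNormal n u p with hν_def
  set K := levelTangent n u p
  set A := hessEndo n p u p with hA
  set w := ‖grad n u p‖ with hw
  have hV : grad n u p = w • ν := grad_eq_smul_unitNormal hgrad
  have hw0 : w ≠ 0 := norm_ne_zero_iff.2 hgrad
  have hu0 : u p ≠ 0 := (hpos p hp).ne'
  have hn1 : (n : ℝ) - 1 ≠ 0 := by
    have : (2 : ℝ) ≤ n := by exact_mod_cast hn
    linarith
  have hsymm : (A : TangentSpace (𝓡 n) p →ₗ[ℝ] TangentSpace (𝓡 n) p).IsSymmetric :=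
    hessEndo_isSymmetric hU hu hp
  have htr := trace_eq_trace_compression_add hν hK
    (A : TangentSpace (𝓡 n) p →ₗ[ℝ] TangentSpace (𝓡 n) p)
  have htr2 := trace_comp_self_eq hν hK hsymm
  have hnorm := norm_sq_eq_projection_add hν hK (A ν)
  have hlap := clmTrace_hessAt_of_laplacian_sq hU hu hpos heq p (mem_chartImage hps hp)
  rw [← trace_hessEndo, chartRead_extChartAt hps, chartRead_extChartAt hps, ← hA, ← hw, htr] at hlap
  rw [laplacian_norm_grad hU hu hpos heq hp hgrad, grad_norm_grad hU hu hp hgrad,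
    grad_sq hU hu hp, vectorBTangent, vectorB_eq hU hu hp hgrad,
    formNormSq_formTraceFree_secondFundamentalForm hU hu hp hgrad, ← hA, ← hν_def, ← hw, htr2]
  have hAV : A (grad n u p) = w • A ν := by rw [hV, map_smul]
  have hip : inner ℝ (A (grad n u p)) (grad n u p) = w ^ 2 * inner ℝ ν (A ν) := by
    rw [hAV]
    conv_lhs => rw [hV]
    rw [inner_smul_left, inner_smul_right, real_inner_comm, conj_trivial]
    ring
  have hnAV : ‖A (grad n u p)‖ ^ 2 = w ^ 2 * ‖A ν‖ ^ 2 := by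
    rw [hAV, norm_smul, mul_pow, Real.norm_eq_abs, sq_abs]
  rw [inner_smul_left, inner_smul_right, hip, hnAV, map_smul, norm_smul, norm_smul, mul_pow, mul_pow,
    Real.norm_eq_abs, sq_abs, hnorm, conj_trivial]
  simp only [ContinuousLinearMap.coe_coe] at hlap ⊢
  rw [real_inner_comm ν] at hlap
  -- Solved for the tangential trace: `tr C = (n - 1) w² / u - ⟪ν, A ν⟫`. After substitution, `tr
  -- C²` and the `w⁴ / u²` terms cancel and a rational identity remains.
  rw [← eq_sub_iff_add_eq] at hlap
  rw [hlap]
  field_simp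
  ring

end UnitNormal

theorem propositionp {n : ℕ} (hn : 2 ≤ n)
    {M : Type*} [TopologicalSpace M] [ChartedSpace (EuclideanSpace ℝ (Fin n)) M]
    [IsManifold (𝓡 n) ∞ M]
    [RiemannianBundle (fun x : M => TangentSpace (𝓡 n) x)]
    [IsContMDiffRiemannianBundle (𝓡 n) ∞ (EuclideanSpace ℝ (Fin n))
      (fun x : M => TangentSpace (𝓡 n) x)]
    (U : Set M) (hU : IsOpen U) (u : M → ℝ)
    (hu : ContMDiffOn (𝓡 n) 𝓘(ℝ, ℝ) ∞ u U) (hpos : ∀ q ∈ U, 0 < u q)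
    (heq : ∀ q ∈ U, laplacian n (fun x => u x ^ 2) q = 2 * (n : ℝ) * ‖grad n u q‖ ^ 2)
    (p : M) (hp : p ∈ U) (hgrad : grad n u p ≠ 0) :
    ContMDiffAt (𝓡 n) 𝓘(ℝ, ℝ) ∞ (fun q => ‖grad n u q‖) p ∧
    laplacian n (fun q => ‖grad n u q‖) p =
      ‖grad n u p‖ * formNormSq (formTraceFree (secondFundamentalForm n u p))
        + ricci n p (grad n u p) (grad n u p) / ‖grad n u p‖
        + ((n : ℝ) - 2) / u p ^ 2 *
            inner ℝ (grad n (fun q => ‖grad n u q‖) p) (grad n (fun q => u q ^ 2) p)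
        + (‖vectorB n u p‖ ^ 2 + ((n : ℝ) - 2) * ‖vectorBTangent n u p‖ ^ 2)
            / (4 * ((n : ℝ) - 1) * ‖grad n u p‖ * u p ^ 2) := by
  exact ⟨contMDiffAt_norm_grad hU hu hp hgrad, laplacian_norm_grad_eq hn hU hu hpos heq hp hgrad⟩
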